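/- Consider the linear model $y = X\beta + \epsilon$ with a fixed design $X \in \mathbb{R}^{n\times p}$ whose columns satisfy $\frac1n X_j^T X_j = 1$, a vector $\beta\in\mathbb{R}^p$ with support $S=\{j:\beta_j\neq 0\}$, $|S| = q$, and independent errors $\epsilon_i \sim N(0,\sigma^2)$, $\sigma>0$. Let $K_1, K_2>0$ and let $c_1,c_2,c_3$ be real with $0\le c_1+c_2<c_3$, $\frac12<c_3<1$ and $(1+3c_2)/2<c_3$ (so $c_2<1/3$). Suppose $p=O(\exp(n^{c_1}))$, $q=O(n^{c_2})$, and (C.1) $\min_{j\in S}|\beta_j| > K_1 n^{(c_3-1)/2}$; (C.2) with $C=\frac1n X^TX$: $v^TCv\ge K_2\|v\|_2^2$ for all $v\in\mathbb{R}^p$ with $\|v_{S^c}\|_1\le 3\|v_S\|_1$. Put $\lambda_0/\sqrt n = 4\sigma\sqrt{\log p}$ and $\lambda/\sqrt n = 4\sigma\sqrt{\log n}$. The Multi Screen Penalty (MSP) iterates are $$\hat\beta^{[1]} = \arg\min_b\Big\{\tfrac12\|y-Xb\|_2^2+\lambda_0\|b\|_1\Big\},\qquad \hat\beta^{[k]}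 = \arg\min_{b:\ b_j=0\ \forall j\notin A^{[k-1]}}\Big\{\tfrac12\|y-Xb\|_2^2+\lambda\sum_{j\in A^{[k-1]}}\big|b_j/\hat\beta^{[k-1]}_j\big|\Big\}\quad (k\ge2),$$ where $A^{[k]}=\{j:\hat\beta^{[k]}_j\ne0\}$; almost surely each $\arg\min$ is assumed to be well defined, i.e. the minimizer is unique. Let $0<K_3<K_1$. Then for all sufficiently large $n$ (the threshold depending only on $c_1,c_2,c_3,K_1,K_2,K_3,\sigma$ and the constants implied in the two $O$'s), with probability at least $1-1/n$ the iterates converge to a vector $\hat\beta$, the sets $A^{[k]}$ eventually equal the support of $\hat\beta$, and $$\|\hat\beta-\beta\|_2\le\frac{8\sigma}{K_2K_3}\sqrt{\frac{q\log n}{n^{c_3}}},\qquad \|\hat\beta-\beta\|_1\le\frac{32\,\sigma q}{K_2K_3}\sqrt{\frac{\log n}{n^{c_3}}}.$$ Moreover, with probability at least $1-1/n$ the iterates converge in the same sense to a vector $\hat\beta$ with $\operatorname{sign}(\hat\beta)=\operatorname{sign}(\beta)$ (componentwise). -/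

import Mathlib

open MeasureTheory ProbabilityTheory Filter Topology
open scoped Matrix

namespace MSP

/-- The `ℓ₂` norm of a coefficient vector. -/
noncomputable def l2Norm {ι : Type*} [Fintype ι] (v : ι → ℝ) : ℝ :=
  ‖(WithLp.toLp 2 v : PiLp 2 fun _ : ι => ℝ)‖

/-- The `ℓ₁` norm of a coefficient vector. -/
noncomputable def l1Norm {ι : Type*} [Fintype ι] (v : ι → ℝ) : ℝ :=
  ‖(WithLp.toLp 1 v : PiLp 1 fun _ : ι => ℝ)‖

/-- The set of indices of the nonzero entries of a vector. -/
noncomputable def supp {p : ℕ} (v : Fin p → ℝ) : Finset (Fin p) :=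
  Finset.univ.filter fun j => v j ≠ 0

/-- `b = arg min_{v ∈ K} f v`: the point `b` of `K` is the one and only minimizer of `f` on `K`. -/
def IsArgMin {α : Type*} (f : α → ℝ) (K : Set α) (b : α) : Prop :=
  b ∈ K ∧ ∀ v ∈ K, v ≠ b → f b < f v

/-- The columns of `X` are standardized: `(1/n) X_jᵀ X_j = 1` for every `j`. -/
def Standardized {n p : ℕ} (X : Matrix (Fin n) (Fin p) ℝ) : Prop :=
  ∀ j, (1 / (n : ℝ)) * ∑ i, X i j * X i j = 1

/-- The Gram matrix `C = (1/n) Xᵀ X`. -/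
noncomputable def gram {n p : ℕ} (X : Matrix (Fin n) (Fin p) ℝ) : Matrix (Fin p) (Fin p) ℝ :=
  (1 / (n : ℝ)) • (Xᵀ * X)

/-- The beta-min condition: `|β_j| > K₁ n^((c₃-1)/2)` for every `j` in the support of `β`. -/
def BetaMin (n : ℕ) {p : ℕ} (β : Fin p → ℝ) (c₃ K₁ : ℝ) : Prop :=
  ∀ j ∈ supp β, K₁ * (n : ℝ) ^ ((c₃ - 1) / 2) < |β j|

/-- The restricted eigenvalue condition on the cone `‖v_{Sᶜ}‖₁ ≤ 3 ‖v_S‖₁`. -/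
def RestrictedEigenvalue {p : ℕ} (C : Matrix (Fin p) (Fin p) ℝ) (S : Finset (Fin p))
    (K₂ : ℝ) : Prop :=
  ∀ v : Fin p → ℝ, ∑ j ∈ Sᶜ, |v j| ≤ 3 * ∑ j ∈ S, |v j| → K₂ * l2Norm v ^ 2 ≤ v ⬝ᵥ (C *ᵥ v)

/-- The Lasso objective `(1/2) ‖y - X b‖₂² + lam0 ‖b‖₁`. -/
noncomputable def lassoObj {n p : ℕ} (X : Matrix (Fin n) (Fin p) ℝ) (y : Fin n → ℝ)
    (lam0 : ℝ) (b : Fin p → ℝ) : ℝ :=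
  (1 / 2) * l2Norm (y - X *ᵥ b) ^ 2 + lam0 * l1Norm b

/-- The objective of one screening step, with the previous iterate `prev` and its active set:
`(1/2) ‖y - X b‖₂² + lam ∑_{j ∈ A} |b_j / prev_j|`. -/
noncomputable def stepObj {n p : ℕ} (X : Matrix (Fin n) (Fin p) ℝ) (y : Fin n → ℝ)
    (lam : ℝ) (prev : Fin p → ℝ) (b : Fin p → ℝ) : ℝ :=
  (1 / 2) * l2Norm (y - X *ᵥ b) ^ 2 + lam * ∑ j ∈ supp prev, |b j / prev j|

/-- The iterates of the Multi Screen Penalty algorithm for the data `(X, y)` and the tuning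
parameters `lam0`, `lam`. Iterates are counted from `0`: `b 0` is the Lasso solution, and
`b (k + 1)` minimizes the reweighted objective over the vectors vanishing off the active set
of `b k`. -/
def IsMSPPath {n p : ℕ} (X : Matrix (Fin n) (Fin p) ℝ) (y : Fin n → ℝ) (lam0 lam : ℝ)
    (b : ℕ → Fin p → ℝ) : Prop :=
  IsArgMin (lassoObj X y lam0) Set.univ (b 0) ∧
    ∀ k, IsArgMin (stepObj X y lam (b k)) {v | ∀ j ∉ supp (b k), v j = 0} (b (k + 1))

/-- The iterates converge to `bhat`, and their active sets become equal to that of `bhat`. -/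
def ConvergesTo {p : ℕ} (b : ℕ → Fin p → ℝ) (bhat : Fin p → ℝ) : Prop :=
  Tendsto b atTop (𝓝 bhat) ∧ ∀ᶠ k in atTop, supp (b k) = supp bhat

/-- The components of the error vector are independent with law `N(0, σ²)`. -/
def IsGaussianNoise {Ω : Type*} [MeasurableSpace Ω] (P : Measure Ω) {n : ℕ}
    (ε : Fin n → Ω → ℝ) (σ : ℝ) : Prop :=
  iIndepFun ε P ∧ ∀ i, HasLaw (ε i) (gaussianReal 0 (Real.toNNReal (σ ^ 2))) P

/-- The event `E` holds with probability at least `a`. (Stated through a measurable subset, so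
that nothing hinges on outer measure.) -/
def HoldsWithProb {Ω : Type*} [MeasurableSpace Ω] (P : Measure Ω) (a : ℝ) (E : Set Ω) : Prop :=
  ∃ G ⊆ E, MeasurableSet G ∧ a ≤ P.real G

end MSP

/-!
The optimality condition of each iterate is used as a variational inequality: a minimizer `b` of
`(1/2) ‖y - X b‖² + ∑ wⱼ |bⱼ|` on a convex set satisfies
`⟨y - X b, X (z - b)⟩ ≤ ∑ wⱼ |zⱼ| - ∑ wⱼ |bⱼ|` for every `z` in the set (`variational_inequality`).
No subgradients are needed.

The analysis of the iterates is deterministic once the noise is favourable (`FavourableNoise`).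
Suppose that an iterate is bounded below by `m` on the true support, is small off it, and that
`|X_jᵀ ε|` times its `j`-th entry is at most `lam / 4` for every false `j` (`IsScreened`). Then the
error of the next iterate lies in the cone of the restricted eigenvalue condition and has `ℓ₂` norm
at most a rate `R` (`step_cone`, `step_l2Norm_le`), so that the next iterate has the same
properties. Moreover the false entries at least halve in each step (`step_shrink`). Since an active
entry has a weight of at most the correlation of its column with the residual (`step_weight_le`),
the false entries vanish after finitely many steps. From then on the active set is the true
support and the iteration is a contraction (`step_contraction`). This gives convergence, the error
bounds and the signs (`path_converges`). The Lasso solution has to be shown to be a suitable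
starting point, and there are two obstacles.

The first is the error of the Lasso. Its penalty level depends on `p`, but the required probability
depends on `n`. If `p` is small compared with `n`, the correlations `Xᵀ ε` may exceed half the
penalty level with probability larger than `1 / n`. Still, by Gaussian concentration the noise is,
outside an event of probability `O(n⁻³)`, within `O(σ √(log n))` of a vector `ε'` whose correlations
are at most `7/16` of the penalty level (`measureReal_nearSet_compl_le`). Concentration follows from
the Prékopa–Leindler inequality (`prekopa_leindler`, `gaussianPi_mul_le`). The contribution of
`ε - ε'` is absorbed by the quadratic term (`lasso_error_dichotomy`, `lasso_entry_error`). For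
`p ≤ 1` the penalty vanishes and the Lasso is least squares.

The second is the product of `|X_jᵀ ε|` and the `j`-th entry of the Lasso solution for false `j`.
If `p` is exponential in `n`, the correlation can be far larger than `lam`, and a bound for each
factor is not enough. If the product is large, the entry is at least `2 s` and the correlation at
least `U`, for suitable thresholds. Replacing `ε` by `ε - s τ X_j`, where `τ` is the sign of the
correlation, subtracts `s τ` from the `j`-th entry of the Lasso solution and leaves the residual
unchanged (`sub_smul_col_mem_largeEntrySet`). This shift multiplies the Gaussian density by an
exponentially large factor (`gaussianPi_shift_le`), so the event for the index `j` is far less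
likely than the shifted one. A unique Lasso solution has at most `n` active entries
(`card_supp_le_of_isArgMin`), hence the `p` shifted events overlap at most `n`-fold, and a union
bound costs only a factor `n` (`measureReal_largeEntry_le`).

The asymptotic relations are collected in `Scale` and hold for large `n` (`eventually_scale`). The
entries of the iterates on the true support exceed `K n ^ ((c₃ - 1) / 2)` with a number `K` between
`K₃` and `K₁`, which yields the constants of the theorem.
-/

namespace MSP

open scoped ENNReal NNReal

/-! ### Norms of coefficient vectors -/

section Norms

variable {ι : Type*} [Fintype ι]

lemma l2Norm_nonneg (v : ι → ℝ) : 0 ≤ l2Norm v := norm_nonneg _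

lemma l2Norm_sq (v : ι → ℝ) : l2Norm v ^ 2 = ∑ i, v i ^ 2 := by
  unfold l2Norm
  rw [PiLp.norm_sq_eq_of_L2]
  simp

lemma l2Norm_sq_eq_dotProduct (v : ι → ℝ) : l2Norm v ^ 2 = v ⬝ᵥ v := by
  rw [l2Norm_sq]
  simp only [dotProduct, sq]

lemma l1Norm_eq_sum (v : ι → ℝ) : l1Norm v = ∑ i, |v i| := by
  unfold l1Norm
  rw [PiLp.norm_eq_of_L1]
  simp

lemma abs_le_l2Norm (v : ι → ℝ) (i : ι) : |v i| ≤ l2Norm v := by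
  apply abs_le_of_sq_le_sq' _ (l2Norm_nonneg v) |> abs_le.2
  rw [l2Norm_sq]
  exact Finset.single_le_sum (f := fun i => v i ^ 2) (fun i _ => sq_nonneg _) (Finset.mem_univ i)

lemma abs_dotProduct_le (v w : ι → ℝ) : |v ⬝ᵥ w| ≤ l2Norm v * l2Norm w := by
  refine abs_le.2 (abs_le_of_sq_le_sq' ?_ (mul_nonneg (l2Norm_nonneg v) (l2Norm_nonneg w)))
  rw [mul_pow, l2Norm_sq, l2Norm_sq]
  exact Finset.sum_mul_sq_le_sq_mul_sq _ _ _

lemma sum_abs_le_sqrt_card_mul_l2Norm (S : Finset ι) (v : ι → ℝ) :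
    ∑ j ∈ S, |v j| ≤ √(S.card : ℝ) * l2Norm v := by
  refine (abs_le_of_sq_le_sq' ?_ (mul_nonneg (Real.sqrt_nonneg _) (l2Norm_nonneg v))).2
  rw [mul_pow, Real.sq_sqrt (Nat.cast_nonneg _), l2Norm_sq]
  calc (∑ j ∈ S, |v j|) ^ 2 ≤ S.card * ∑ j ∈ S, |v j| ^ 2 := sq_sum_le_card_mul_sum_sq
    _ ≤ S.card * ∑ j, v j ^ 2 := by
      gcongr
      simp only [sq_abs]
      exact Finset.sum_le_sum_of_subset_of_nonneg (Finset.subset_univ _)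
        fun i _ _ => sq_nonneg _

lemma norm_le_l2Norm (v : ι → ℝ) : ‖v‖ ≤ l2Norm v :=
  (pi_norm_le_iff_of_nonneg (l2Norm_nonneg v)).2 fun i => abs_le_l2Norm v i

lemma abs_dotProduct_le_sum (w : ι → ℝ) (v : ι → ℝ) {c : ℝ} (h : ∀ j, |w j| ≤ c) :
    |w ⬝ᵥ v| ≤ c * ∑ j, |v j| := by
  rw [Finset.mul_sum]
  refine (Finset.abs_sum_le_sum_abs _ _).trans (Finset.sum_le_sum fun j _ => ?_)
  rw [abs_mul]
  exact mul_le_mul_of_nonneg_right (h j) (abs_nonneg _)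

end Norms

lemma mem_supp {p : ℕ} {v : Fin p → ℝ} {j : Fin p} : j ∈ supp v ↔ v j ≠ 0 := by
  simp [supp]

section Design

variable {n p : ℕ} (X : Matrix (Fin n) (Fin p) ℝ)

lemma dotProduct_mulVec_eq (r : Fin n → ℝ) (v : Fin p → ℝ) :
    r ⬝ᵥ (X *ᵥ v) = (Xᵀ *ᵥ r) ⬝ᵥ v := by
  rw [Matrix.dotProduct_mulVec, Matrix.mulVec_transpose]

lemma col_dotProduct_self {X : Matrix (Fin n) (Fin p) ℝ} (hX : Standardized X) (hn : 0 < n)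
    (j : Fin p) : (fun i => X i j) ⬝ᵥ (fun i => X i j) = n := by
  have := hX j
  have hn' : (n : ℝ) ≠ 0 := by positivity
  field_simp at this
  simpa [dotProduct, sq] using this

lemma l2Norm_col {X : Matrix (Fin n) (Fin p) ℝ} (hX : Standardized X) (hn : 0 < n)
    (j : Fin p) : l2Norm (fun i => X i j) = √(n : ℝ) := by
  rw [← col_dotProduct_self hX hn j, ← l2Norm_sq_eq_dotProduct,
    Real.sqrt_sq (l2Norm_nonneg _)]

lemma transpose_mulVec_apply (r : Fin n → ℝ) (j : Fin p) :
    (Xᵀ *ᵥ r) j = (fun i => X i j) ⬝ᵥ r := rfl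

lemma abs_transpose_mulVec_le {X : Matrix (Fin n) (Fin p) ℝ} (hX : Standardized X) (hn : 0 < n)
    (r : Fin n → ℝ) (j : Fin p) : |(Xᵀ *ᵥ r) j| ≤ √(n : ℝ) * l2Norm r := by
  rw [transpose_mulVec_apply, ← l2Norm_col hX hn j]
  exact abs_dotProduct_le _ _

lemma gram_quadratic (hn : 0 < n) (v : Fin p → ℝ) :
    (n : ℝ) * (v ⬝ᵥ (gram X *ᵥ v)) = l2Norm (X *ᵥ v) ^ 2 := by
  have hn' : (n : ℝ) ≠ 0 := by positivity
  rw [gram, Matrix.smul_mulVec, dotProduct_smul, smul_eq_mul, ← mul_assoc,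
    mul_one_div_cancel hn', one_mul, ← Matrix.mulVec_mulVec, dotProduct_comm,
    Matrix.mulVec_transpose, ← Matrix.dotProduct_mulVec, l2Norm_sq_eq_dotProduct]

/-- The restricted eigenvalue condition, in terms of the fitted vector `X v`. -/
lemma RestrictedEigenvalue.le_l2Norm_mulVec {X : Matrix (Fin n) (Fin p) ℝ} {S : Finset (Fin p)}
    {K₂ : ℝ} (h : RestrictedEigenvalue (gram X) S K₂) (hn : 0 < n) {v : Fin p → ℝ}
    (hv : ∑ j ∈ Sᶜ, |v j| ≤ 3 * ∑ j ∈ S, |v j|) :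
    n * K₂ * l2Norm v ^ 2 ≤ l2Norm (X *ᵥ v) ^ 2 := by
  rw [← gram_quadratic X hn, mul_assoc]
  exact mul_le_mul_of_nonneg_left (h v hv) (Nat.cast_nonneg n)

/-! ### Penalized least squares and its variational inequality -/

/-- The least squares objective with a weighted `ℓ₁` penalty,
`(1/2) ‖y - X b‖₂² + ∑ⱼ wⱼ |bⱼ|`. -/
noncomputable def penObj (y : Fin n → ℝ) (w b : Fin p → ℝ) : ℝ :=
  (1 / 2) * l2Norm (y - X *ᵥ b) ^ 2 + ∑ j, w j * |b j|

lemma lassoObj_eq_penObj (y : Fin n → ℝ) (lam0 : ℝ) (b : Fin p → ℝ) :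
    lassoObj X y lam0 b = penObj X y (fun _ => lam0) b := by
  rw [lassoObj, penObj, l1Norm_eq_sum, Finset.mul_sum]

/-- A screening step is penalized least squares with the weights `lam / |prevⱼ|`; off the active
set the weight is `lam / 0 = 0`, in accordance with the sum over the active set. -/
lemma stepObj_eq_penObj (y : Fin n → ℝ) (lam : ℝ) (prev b : Fin p → ℝ) :
    stepObj X y lam prev b = penObj X y (fun j => lam / |prev j|) b := by
  rw [stepObj, penObj, Finset.mul_sum]
  congr 1
  rw [← Finset.sum_subset (Finset.subset_univ (supp prev))]
  · refine Finset.sum_congr rfl fun j _ => ?_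
    rw [abs_div]
    ring
  · intro j _ hj
    have : prev j = 0 := by simpa [mem_supp] using hj
    simp [this]

lemma l2Norm_sub_sq (r s : Fin n → ℝ) :
    l2Norm (r - s) ^ 2 = l2Norm r ^ 2 - 2 * (r ⬝ᵥ s) + l2Norm s ^ 2 := by
  simp only [l2Norm_sq_eq_dotProduct, sub_dotProduct, dotProduct_sub, dotProduct_comm s r]
  ring

lemma penObj_eq_add (y : Fin n → ℝ) (w b z : Fin p → ℝ) :
    penObj X y w z = penObj X y w b - (y - X *ᵥ b) ⬝ᵥ (X *ᵥ (z - b))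
      + (1 / 2) * l2Norm (X *ᵥ (z - b)) ^ 2 + (∑ j, w j * |z j| - ∑ j, w j * |b j|) := by
  have h : y - X *ᵥ z = (y - X *ᵥ b) - X *ᵥ (z - b) := by
    rw [Matrix.mulVec_sub]; abel
  unfold penObj
  rw [h, l2Norm_sub_sq]
  ring

/-- The first-order optimality condition of penalized least squares on a convex set, as a
variational inequality. It encodes the subgradient conditions without derivatives. -/
lemma variational_inequality {y : Fin n → ℝ} {w b : Fin p → ℝ} {K : Set (Fin p → ℝ)}
    (hK : Convex ℝ K) (hw : ∀ j, 0 ≤ w j) (hb : b ∈ K)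
    (hmin : ∀ v ∈ K, penObj X y w b ≤ penObj X y w v) {z : Fin p → ℝ} (hz : z ∈ K) :
    (y - X *ᵥ b) ⬝ᵥ (X *ᵥ (z - b)) ≤ ∑ j, w j * |z j| - ∑ j, w j * |b j| := by
  set a := (y - X *ᵥ b) ⬝ᵥ (X *ᵥ (z - b)) with ha
  set B := l2Norm (X *ᵥ (z - b)) ^ 2 with hB
  set D := ∑ j, w j * |z j| - ∑ j, w j * |b j| with hD
  have hB0 : 0 ≤ B := sq_nonneg _
  have key : ∀ t : ℝ, 0 < t → t ≤ 1 → a ≤ t * B / 2 + D := by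
    intro t ht ht1
    have hmem : b + t • (z - b) ∈ K := by
      have := hK hb hz (sub_nonneg.2 ht1) ht.le (by ring)
      convert this using 1
      ext j; simp; ring
    have h1 := hmin _ hmem
    rw [penObj_eq_add X y w b (b + t • (z - b))] at h1
    have e1 : b + t • (z - b) - b = t • (z - b) := by abel
    have e2 : l2Norm (t • (X *ᵥ (z - b))) ^ 2 = t ^ 2 * B := by
      rw [hB, l2Norm_sq, l2Norm_sq, Finset.mul_sum]
      exact Finset.sum_congr rfl fun i _ => by simp [mul_pow]
    rw [e1, Matrix.mulVec_smul, dotProduct_smul, e2, ← ha, smul_eq_mul] at h1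
    have h2 : ∑ j, w j * |(b + t • (z - b)) j| - ∑ j, w j * |b j| ≤ t * D := by
      rw [hD, ← Finset.sum_sub_distrib, ← Finset.sum_sub_distrib, Finset.mul_sum]
      refine Finset.sum_le_sum fun j _ => ?_
      have : |(b + t • (z - b)) j| ≤ (1 - t) * |b j| + t * |z j| := by
        have e : (b + t • (z - b)) j = (1 - t) * b j + t * z j := by simp; ring
        rw [e]
        refine (abs_add_le _ _).trans ?_
        rw [abs_mul, abs_mul, abs_of_nonneg (sub_nonneg.2 ht1), abs_of_pos ht]
      nlinarith [mul_le_mul_of_nonneg_left this (hw j)]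
    have h3 : t * a ≤ t * (t * B / 2 + D) := by nlinarith
    exact le_of_mul_le_mul_left h3 ht
  by_contra! hlt
  have hpos : 0 < (a - D) / (B + 1) := div_pos (by linarith) (by linarith)
  have h := key (min 1 ((a - D) / (B + 1))) (lt_min one_pos hpos) (min_le_left _ _)
  have h2 : min 1 ((a - D) / (B + 1)) * B ≤ (a - D) / (B + 1) * (B + 1) :=
    mul_le_mul (min_le_right _ _) (by linarith) hB0 hpos.le
  rw [div_mul_cancel₀ _ (by linarith)] at h2
  linarith

lemma penObj_le_of_variational {y : Fin n → ℝ} {w b : Fin p → ℝ} {z : Fin p → ℝ}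
    (h : (y - X *ᵥ b) ⬝ᵥ (X *ᵥ (z - b)) ≤ ∑ j, w j * |z j| - ∑ j, w j * |b j|) :
    penObj X y w b ≤ penObj X y w z := by
  rw [penObj_eq_add X y w b z]
  nlinarith [sq_nonneg (l2Norm (X *ᵥ (z - b)))]

/-- The variational inequality of a minimizer, tested at the true coefficient vector. -/
lemma basic_inequality {β b w : Fin p → ℝ} {ε : Fin n → ℝ}
    (h : (X *ᵥ β + ε - X *ᵥ b) ⬝ᵥ (X *ᵥ (β - b)) ≤ ∑ j, w j * |β j| - ∑ j, w j * |b j|) :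
    l2Norm (X *ᵥ (b - β)) ^ 2 ≤ ε ⬝ᵥ (X *ᵥ (b - β)) + (∑ j, w j * |β j| - ∑ j, w j * |b j|) := by
  have e1 : X *ᵥ β + ε - X *ᵥ b = ε - X *ᵥ (b - β) := by rw [Matrix.mulVec_sub]; abel
  have e2 : X *ᵥ (β - b) = - (X *ᵥ (b - β)) := by rw [← Matrix.mulVec_neg, neg_sub]
  rw [e1, e2, dotProduct_neg, sub_dotProduct, ← l2Norm_sq_eq_dotProduct] at h
  linarith

end Design

/-! ### The Prékopa–Leindler inequality -/

/-- The one-dimensional Brunn–Minkowski inequality for compact sets: a translate of `A` and a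
translate of `B`, placed end to end, fit into `A + B`. -/
lemma volume_add_le_of_isCompact {A B C : Set ℝ} (hA : IsCompact A) (hB : IsCompact B)
    (hA₀ : A.Nonempty) (hB₀ : B.Nonempty) (h : ∀ a ∈ A, ∀ b ∈ B, a + b ∈ C) :
    volume A + volume B ≤ volume C := by
  have hM : sSup A ∈ A := hA.sSup_mem hA₀
  have hm : sInf B ∈ B := hB.sInf_mem hB₀
  have h1 : volume ((fun x => x + sInf B) '' A) = volume A := by
    rw [Set.image_add_right, measure_preimage_add_right]
  have h2 : volume ((fun x => sSup A + x) '' B) = volume B := by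
    rw [Set.image_add_left, measure_preimage_add]
  have hd : AEDisjoint volume ((fun x => x + sInf B) '' A) ((fun x => sSup A + x) '' B) := by
    have : ((fun x => x + sInf B) '' A) ∩ ((fun x => sSup A + x) '' B) ⊆ {sSup A + sInf B} := by
      rintro z ⟨⟨a, ha, rfl⟩, ⟨b, hb, hab⟩⟩
      have e1 : a ≤ sSup A := le_csSup hA.bddAbove ha
      have e2 : sInf B ≤ b := csInf_le hB.bddBelow hb
      simp only [Set.mem_singleton_iff] at hab ⊢
      linarith
    exact measure_mono_null this (by simp)
  rw [← h1, ← h2, ← measure_union₀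
    ((hB.image (by fun_prop)).measurableSet.nullMeasurableSet) hd]
  refine measure_mono (Set.union_subset ?_ ?_)
  · rintro _ ⟨a, ha, rfl⟩
    exact h a ha _ hm
  · rintro _ ⟨b, hb, rfl⟩
    exact h _ hM b hb

/-- The one-dimensional Brunn–Minkowski inequality. -/
lemma volume_add_le {A B C : Set ℝ} (hA : MeasurableSet A) (hB : MeasurableSet B)
    (hA₀ : A.Nonempty) (hB₀ : B.Nonempty) (h : ∀ a ∈ A, ∀ b ∈ B, a + b ∈ C) :
    volume A + volume B ≤ volume C := by
  have key : ∀ K ⊆ A, ∀ K' ⊆ B, IsCompact K → IsCompact K' → volume K + volume K' ≤ volume C := by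
    intro K hK K' hK' cK cK'
    obtain ⟨a, ha⟩ := hA₀
    obtain ⟨b, hb⟩ := hB₀
    -- adjoining one point to each set makes both nonempty without leaving `A` and `B`
    refine le_trans (add_le_add (measure_mono (Set.subset_insert a K))
      (measure_mono (Set.subset_insert b K'))) ?_
    exact volume_add_le_of_isCompact (cK.insert a) (cK'.insert b) (by simp) (by simp)
      fun x hx y hy => h x (Set.insert_subset ha hK hx) y (Set.insert_subset hb hK' hy)
  have hsup : ∀ D : Set ℝ, MeasurableSet D →
      volume D = ⨆ (K : Set ℝ) (_ : K ⊆ D ∧ IsCompact K), volume K := fun D hD => by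
    simp only [hD.measure_eq_iSup_isCompact, iSup_and]
  rw [hsup A hA, hsup B hB]
  refine ENNReal.biSup_add_biSup_le' ⟨∅, by simp⟩ ⟨∅, by simp⟩ ?_
  rintro K ⟨hK, cK⟩ K' ⟨hK', cK'⟩
  exact key K hK K' hK' cK cK'

lemma four_mul_le_add_sq (a b : ℝ≥0∞) : 4 * (a * b) ≤ (a + b) ^ 2 := by
  rcases eq_or_ne a ∞ with rfl | ha
  · simp
  rcases eq_or_ne b ∞ with rfl | hb
  · simp
  lift a to NNReal using ha
  lift b to NNReal using hb
  norm_cast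
  rw [← NNReal.coe_le_coe]
  push_cast
  nlinarith [sq_nonneg ((a : ℝ) - b)]

/-- The additive form of the Prékopa–Leindler inequality on the line, for functions whose
supremum is `1`: their superlevel sets obey the Brunn–Minkowski inequality. -/
lemma lintegral_add_le_of_sup_one {f g h : ℝ → ℝ} (hf : Measurable f) (hg : Measurable g)
    (hh : Measurable h) (hf₀ : ∀ x, 0 ≤ f x) (hg₀ : ∀ x, 0 ≤ g x) (hh₀ : ∀ x, 0 ≤ h x)
    (hf₁ : ∀ x, f x ≤ 1) (hg₁ : ∀ x, g x ≤ 1) (hf₂ : ∀ t < 1, ∃ x, t < f x)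
    (hg₂ : ∀ t < 1, ∃ x, t < g x) (hfg : ∀ x y, f x * g y ≤ h (x + y) ^ 2) :
    (∫⁻ x, ENNReal.ofReal (f x)) + ∫⁻ x, ENNReal.ofReal (g x) ≤ ∫⁻ x, ENNReal.ofReal (h x) := by
  rw [lintegral_eq_lintegral_meas_lt _ (.of_forall hf₀) hf.aemeasurable,
    lintegral_eq_lintegral_meas_lt _ (.of_forall hg₀) hg.aemeasurable,
    lintegral_eq_lintegral_meas_lt _ (.of_forall hh₀) hh.aemeasurable]
  have hanti : Antitone fun t : ℝ => volume {x | t < f x} :=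
    fun s t hst => measure_mono fun x (hx : t < f x) => lt_of_le_of_lt hst hx
  rw [← lintegral_add_left hanti.measurable]
  refine setLIntegral_mono' measurableSet_Ioi fun t (ht : 0 < t) => ?_
  rcases lt_or_ge t 1 with ht1 | ht1
  · refine volume_add_le (measurableSet_lt measurable_const hf)
      (measurableSet_lt measurable_const hg) (hf₂ t ht1) (hg₂ t ht1) ?_
    intro a (ha : t < f a) b (hb : t < g b)
    have h1 : t ^ 2 < h (a + b) ^ 2 := by nlinarith [hfg a b]
    exact lt_of_pow_lt_pow_left₀ 2 (hh₀ _) h1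
  · have e1 : {x | t < f x} = ∅ := by
      ext x; simpa using (hf₁ x).trans ht1
    have e2 : {x | t < g x} = ∅ := by
      ext x; simpa using (hg₁ x).trans ht1
    simp [e1, e2]

/-- The Prékopa–Leindler inequality on the line, for bounded functions. -/
lemma prekopa_leindler_real_of_bounded {f g h : ℝ → ℝ≥0∞} (hf : Measurable f) (hg : Measurable g)
    (hh : Measurable h) {N : ℝ≥0∞} (hN : N ≠ ∞) (hfN : ∀ x, f x ≤ N) (hgN : ∀ x, g x ≤ N)
    (hfg : ∀ x y, f x * g y ≤ h (x + y) ^ 2) :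
    4 * ((∫⁻ x, f x) * ∫⁻ x, g x) ≤ (∫⁻ x, h x) ^ 2 := by
  -- `h` may be truncated at `N` as well, which makes all three functions real-valued
  wlog hhN : ∀ x, h x ≤ N generalizing h
  · refine (this (h := fun x => min (h x) N) (hh.min measurable_const) (fun x y => ?_)
      (fun x => min_le_right _ _)).trans ?_
    · rcases le_total (h (x + y)) N with h1 | h1
      · rw [min_eq_left h1]; exact hfg x y
      · rw [min_eq_right h1, sq]
        exact mul_le_mul' (hfN x) (hgN y)
    · gcongr with x
      exact min_le_left _ _
  set F := ⨆ x, f x with hF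
  set G := ⨆ x, g x with hG
  have hFt : F ≠ ∞ := ne_top_of_le_ne_top hN (iSup_le hfN)
  have hGt : G ≠ ∞ := ne_top_of_le_ne_top hN (iSup_le hgN)
  rcases eq_or_ne F 0 with hF0 | hF0
  · have : ∀ x, f x = 0 := fun x => by
      have := le_iSup f x
      rw [← hF, hF0] at this
      exact le_antisymm this bot_le
    simp [this]
  rcases eq_or_ne G 0 with hG0 | hG0
  · have : ∀ x, g x = 0 := fun x => by
      have := le_iSup g x
      rw [← hG, hG0] at this
      exact le_antisymm this bot_le
    simp [this]
  have hFpos : 0 < F.toReal := ENNReal.toReal_pos hF0 hFt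
  have hGpos : 0 < G.toReal := ENNReal.toReal_pos hG0 hGt
  set r := √(F.toReal * G.toReal) with hr
  have hrpos : 0 < r := Real.sqrt_pos.2 (mul_pos hFpos hGpos)
  have hr2 : r ^ 2 = F.toReal * G.toReal := Real.sq_sqrt (mul_pos hFpos hGpos).le
  have hft : ∀ x, f x ≠ ∞ := fun x => ne_top_of_le_ne_top hN (hfN x)
  have hgt : ∀ x, g x ≠ ∞ := fun x => ne_top_of_le_ne_top hN (hgN x)
  have hht : ∀ x, h x ≠ ∞ := fun x => ne_top_of_le_ne_top hN (hhN x)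
  have hsup : ∀ (f : ℝ → ℝ≥0∞), (⨆ x, f x) ≠ ∞ → (⨆ x, f x) ≠ 0 → (∀ x, f x ≠ ∞) →
      ∀ t < 1, ∃ x, t < (f x).toReal / (⨆ x, f x).toReal := by
    intro f h1 h2 h3 t ht
    have hpos := ENNReal.toReal_pos h2 h1
    by_contra! hcon
    have : (⨆ x, f x) ≤ ENNReal.ofReal (t * (⨆ x, f x).toReal) := iSup_le fun x => by
      rw [← ENNReal.ofReal_toReal (h3 x)]
      exact ENNReal.ofReal_le_ofReal ((div_le_iff₀ hpos).1 (hcon x))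
    have h4 := ENNReal.toReal_mono ENNReal.ofReal_ne_top this
    rcases le_or_gt 0 t with ht0 | ht0
    · rw [ENNReal.toReal_ofReal (by positivity)] at h4
      nlinarith
    · rw [ENNReal.ofReal_of_nonpos (by nlinarith)] at h4
      simp only [ENNReal.toReal_zero] at h4
      linarith
  have key := lintegral_add_le_of_sup_one (f := fun x => (f x).toReal / F.toReal)
    (g := fun x => (g x).toReal / G.toReal) (h := fun x => (h x).toReal / r)
    (by fun_prop) (by fun_prop) (by fun_prop) (fun x => by positivity) (fun x => by positivity)
    (fun x => by positivity)
    (fun x => (div_le_one hFpos).2 (ENNReal.toReal_mono hFt (le_iSup f x)))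
    (fun x => (div_le_one hGpos).2 (ENNReal.toReal_mono hGt (le_iSup g x)))
    (hsup f hFt hF0 hft) (hsup g hGt hG0 hgt) (fun x y => by
      have h1 := ENNReal.toReal_mono (ENNReal.pow_ne_top (hht (x + y))) (hfg x y)
      rw [ENNReal.toReal_mul, ENNReal.toReal_pow] at h1
      rw [div_mul_div_comm, div_pow, hr2]
      gcongr)
  have hdiv : ∀ (k : ℝ → ℝ≥0∞) (c : ℝ), Measurable k → 0 < c → (∀ x, k x ≠ ∞) →
      ∫⁻ x, ENNReal.ofReal ((k x).toReal / c) = (ENNReal.ofReal c)⁻¹ * ∫⁻ x, k x := by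
    intro k c hk hc h1
    rw [← lintegral_const_mul _ hk]
    refine lintegral_congr fun x => ?_
    rw [ENNReal.ofReal_div_of_pos hc, ENNReal.ofReal_toReal (h1 x), div_eq_mul_inv, mul_comm]
  rw [hdiv f _ hf hFpos hft, hdiv g _ hg hGpos hgt, hdiv h _ hh hrpos hht] at key
  have hr0 : ENNReal.ofReal r ≠ 0 := by simpa using hrpos
  have hFG : (ENNReal.ofReal r) ^ 2 * ((ENNReal.ofReal F.toReal)⁻¹ *
      (ENNReal.ofReal G.toReal)⁻¹) = 1 := by
    rw [← ENNReal.ofReal_pow hrpos.le, hr2, ENNReal.ofReal_mul hFpos.le,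
      ← ENNReal.mul_inv (by simp [hFpos]) (by simp)]
    exact ENNReal.mul_inv_cancel (by simp [hFpos, hGpos]) (by finiteness)
  calc 4 * ((∫⁻ x, f x) * ∫⁻ x, g x)
      = (ENNReal.ofReal r) ^ 2 * (4 * (((ENNReal.ofReal F.toReal)⁻¹ * ∫⁻ x, f x) *
          ((ENNReal.ofReal G.toReal)⁻¹ * ∫⁻ x, g x))) := by
        rw [show (ENNReal.ofReal r) ^ 2 * (4 * (((ENNReal.ofReal F.toReal)⁻¹ * ∫⁻ x, f x) *
          ((ENNReal.ofReal G.toReal)⁻¹ * ∫⁻ x, g x))) = ((ENNReal.ofReal r) ^ 2 *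
          ((ENNReal.ofReal F.toReal)⁻¹ * (ENNReal.ofReal G.toReal)⁻¹)) *
          (4 * ((∫⁻ x, f x) * ∫⁻ x, g x)) by ring, hFG, one_mul]
    _ ≤ (ENNReal.ofReal r) ^ 2 * ((ENNReal.ofReal r)⁻¹ * ∫⁻ x, h x) ^ 2 := by
        gcongr
        exact (four_mul_le_add_sq _ _).trans (by gcongr)
    _ = (∫⁻ x, h x) ^ 2 := by
        rw [← mul_pow, ← mul_assoc, ENNReal.mul_inv_cancel hr0 (by finiteness), one_mul]

/-- The Prékopa–Leindler inequality on the line, with `x + y` in place of the midpoint. -/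
lemma prekopa_leindler_real {f g h : ℝ → ℝ≥0∞} (hf : Measurable f) (hg : Measurable g)
    (hh : Measurable h) (hfg : ∀ x y, f x * g y ≤ h (x + y) ^ 2) :
    4 * ((∫⁻ x, f x) * ∫⁻ x, g x) ≤ (∫⁻ x, h x) ^ 2 := by
  have htr : ∀ k : ℝ → ℝ≥0∞, Measurable k →
      ∫⁻ x, k x = ⨆ N : ℕ, ∫⁻ x, min (k x) N := by
    intro k hk
    rw [← lintegral_iSup (fun N => hk.min measurable_const)
      (fun a b hab x => min_le_min_left _ (by exact_mod_cast hab))]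
    refine lintegral_congr fun x => ?_
    rw [← inf_iSup_eq, ENNReal.iSup_natCast, inf_top_eq]
  have hmono : ∀ k : ℝ → ℝ≥0∞, Monotone fun N : ℕ => ∫⁻ x, min (k x) (N : ℝ≥0∞) :=
    fun k a b hab => lintegral_mono fun x => min_le_min_left _ (by exact_mod_cast hab)
  rw [htr f hf, htr g hg]
  simp only [ENNReal.iSup_mul, ENNReal.mul_iSup]
  refine iSup_le fun N => iSup_le fun N' => ?_
  refine le_trans (mul_le_mul_right (mul_le_mul' (hmono f (le_max_left N' N))
    (hmono g (le_max_right N' N))) 4) ?_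
  refine prekopa_leindler_real_of_bounded (hf.min measurable_const) (hg.min measurable_const) hh
    (ENNReal.natCast_ne_top _) (fun x => min_le_right _ _) (fun x => min_le_right _ _) ?_
  exact fun x y => (mul_le_mul' (min_le_left _ _) (min_le_left _ _)).trans (hfg x y)

lemma lintegral_fin_succ {n : ℕ} (f : (Fin (n + 1) → ℝ) → ℝ≥0∞) (hf : Measurable f) :
    ∫⁻ x, f x = ∫⁻ a : ℝ, ∫⁻ v : Fin n → ℝ, f (Fin.cons a v) := by
  rw [← (volume_preserving_piFinSuccAbove (fun _ : Fin (n + 1) => ℝ) 0).symm.lintegral_comp hf,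
    Measure.volume_eq_prod, lintegral_prod _ (by fun_prop)]
  simp [MeasurableEquiv.piFinSuccAbove_symm_apply, Fin.insertNthEquiv]

/-- The Prékopa–Leindler inequality on `ℝⁿ`, with `x + y` in place of the midpoint. -/
lemma prekopa_leindler : ∀ {n : ℕ} {f g h : (Fin n → ℝ) → ℝ≥0∞}, Measurable f → Measurable g →
    Measurable h → (∀ x y, f x * g y ≤ h (x + y) ^ 2) →
    4 ^ n * ((∫⁻ x, f x) * ∫⁻ x, g x) ≤ (∫⁻ x, h x) ^ 2
  | 0, f, g, h, hf, hg, hh, hfg => by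
    rw [volume_pi, Measure.pi_of_empty _ 0]
    simpa [lintegral_dirac' _ hf, lintegral_dirac' _ hg, lintegral_dirac' _ hh] using hfg 0 0
  | n + 1, f, g, h, hf, hg, hh, hfg => by
    have hc : Measurable fun z : ℝ × (Fin n → ℝ) => (Fin.cons z.1 z.2 : Fin (n + 1) → ℝ) :=
      measurable_pi_lambda _ fun i => by
        refine Fin.cases ?_ (fun i => ?_) i <;> simp <;> fun_prop
    have hm : ∀ k : (Fin (n + 1) → ℝ) → ℝ≥0∞, Measurable k →
        Measurable fun a : ℝ => ∫⁻ v : Fin n → ℝ, k (Fin.cons a v) :=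
      fun k hk => (hk.comp hc).lintegral_prod_right'
    have hs : ∀ (a : ℝ), Measurable fun v : Fin n → ℝ => (Fin.cons a v : Fin (n + 1) → ℝ) :=
      fun a => hc.comp measurable_prodMk_left
    have key := prekopa_leindler_real
      (f := fun a => 2 ^ n * ∫⁻ v : Fin n → ℝ, f (Fin.cons a v))
      (g := fun a => 2 ^ n * ∫⁻ v : Fin n → ℝ, g (Fin.cons a v))
      (h := fun a => ∫⁻ v : Fin n → ℝ, h (Fin.cons a v))
      ((hm f hf).const_mul _) ((hm g hg).const_mul _) (hm h hh) (fun a b => by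
        have := prekopa_leindler (hf.comp (hs a)) (hg.comp (hs b)) (hh.comp (hs (a + b)))
          (fun v w => by
            refine (hfg _ _).trans_eq ?_
            congr 2
            ext i
            refine Fin.cases ?_ (fun i => ?_) i <;> simp)
        refine le_trans (le_of_eq ?_) this
        rw [show (4 : ℝ≥0∞) = 2 * 2 by norm_num, mul_pow]
        simp only [Function.comp_apply]
        ring)
    rw [lintegral_const_mul _ (hm f hf), lintegral_const_mul _ (hm g hg),
      ← lintegral_fin_succ f hf, ← lintegral_fin_succ g hg, ← lintegral_fin_succ h hh] at key
    refine le_trans (le_of_eq ?_) key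
    rw [pow_succ, show (4 : ℝ≥0∞) = 2 * 2 by norm_num, mul_pow]
    ring

/-! ### Gaussian noise vectors -/

/-- The law of a vector of `n` independent centred Gaussian variables of variance `v`. -/
noncomputable abbrev gaussianPi (n : ℕ) (v : ℝ≥0) : Measure (Fin n → ℝ) :=
  Measure.pi fun _ => gaussianReal 0 v

lemma lintegral_prod_fin : ∀ {n : ℕ} {f : Fin n → ℝ → ℝ≥0∞}, (∀ i, Measurable (f i)) →
    ∫⁻ x : Fin n → ℝ, ∏ i, f i (x i) = ∏ i, ∫⁻ x, f i x
  | 0, f, hf => by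
    rw [volume_pi, Measure.pi_of_empty _ 0]
    simp
  | n + 1, f, hf => by
    rw [lintegral_fin_succ _ (Finset.measurable_prod _ fun i _ => by fun_prop)]
    simp only [Fin.prod_univ_succ, Fin.cons_zero, Fin.cons_succ]
    rw [← lintegral_prod_fin fun i => hf i.succ, ← lintegral_mul_const _ (hf 0)]
    refine lintegral_congr fun a => ?_
    rw [lintegral_const_mul _ (Finset.measurable_prod _ fun i _ => by fun_prop)]

lemma gaussianPi_eq_withDensity (n : ℕ) {v : ℝ≥0} (hv : v ≠ 0) :
    gaussianPi n v = volume.withDensity fun x => ∏ i, gaussianPDF 0 v (x i) := by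
  symm
  refine (Measure.pi_eq fun s hs => ?_).symm
  rw [withDensity_apply _ (MeasurableSet.univ_pi hs), ← lintegral_indicator (.univ_pi hs)]
  have : ∀ x : Fin n → ℝ, (Set.univ.pi s).indicator (fun x => ∏ i, gaussianPDF 0 v (x i)) x
      = ∏ i, (s i).indicator (gaussianPDF 0 v) (x i) := by
    intro x
    by_cases hx : x ∈ Set.univ.pi s
    · rw [Set.indicator_of_mem hx]
      exact Finset.prod_congr rfl fun i _ => (Set.indicator_of_mem (hx i trivial) _).symm
    · rw [Set.indicator_of_notMem hx]
      simp only [Set.mem_pi, Set.mem_univ, forall_const, not_forall] at hx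
      obtain ⟨i, hi⟩ := hx
      exact (Finset.prod_eq_zero (Finset.mem_univ i) (Set.indicator_of_notMem hi _)).symm
  simp only [this]
  rw [lintegral_prod_fin fun i => (measurable_gaussianPDF 0 v).indicator (hs i)]
  refine Finset.prod_congr rfl fun i _ => ?_
  rw [gaussianReal_apply 0 hv, lintegral_indicator (hs i)]

lemma prod_gaussianPDF {n : ℕ} (v : ℝ≥0) (x : Fin n → ℝ) :
    ∏ i, gaussianPDF 0 v (x i)
      = ENNReal.ofReal ((√(2 * Real.pi * v))⁻¹ ^ n * Real.exp (-(l2Norm x ^ 2) / (2 * v))) := by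
  simp only [gaussianPDF]
  rw [← ENNReal.ofReal_prod_of_nonneg fun i _ => gaussianPDFReal_nonneg _ _ _]
  congr 1
  simp only [gaussianPDFReal, Finset.prod_mul_distrib, ← Real.exp_sum, sub_zero, l2Norm_sq]
  simp [Finset.sum_div, Finset.sum_neg_distrib, neg_div]

lemma l2Norm_add_sq {n : ℕ} (r s : Fin n → ℝ) :
    l2Norm (r + s) ^ 2 = l2Norm r ^ 2 + 2 * (r ⬝ᵥ s) + l2Norm s ^ 2 := by
  simp only [l2Norm_sq_eq_dotProduct, add_dotProduct, dotProduct_add, dotProduct_comm s r]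
  ring

lemma l2Norm_smul_sq {ι : Type*} [Fintype ι] (c : ℝ) (s : ι → ℝ) :
    l2Norm (c • s) ^ 2 = c ^ 2 * l2Norm s ^ 2 := by
  simp [l2Norm_sq, mul_pow, Finset.mul_sum]

/-- Gaussian concentration: two sets at Euclidean distance `√R` cannot both have large Gaussian
measure. This is the Prékopa–Leindler inequality for the Gaussian density restricted to the two
sets, and the parallelogram identity. -/
lemma gaussianPi_mul_le {n : ℕ} {v : ℝ≥0} (hv : v ≠ 0) {A B : Set (Fin n → ℝ)}
    (hA : MeasurableSet A) (hB : MeasurableSet B) {R : ℝ}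
    (h : ∀ x ∈ A, ∀ y ∈ B, R ≤ l2Norm (x - y) ^ 2) :
    gaussianPi n v A * gaussianPi n v B ≤ ENNReal.ofReal (Real.exp (-R / (4 * v))) := by
  have hvpos : (0 : ℝ) < v := by positivity
  have hm : Measurable fun x : Fin n → ℝ => ∏ i, gaussianPDF 0 v (x i) :=
    Finset.measurable_prod _ fun i _ => (measurable_gaussianPDF 0 v).comp (measurable_pi_apply i)
  have hm2 : Measurable fun x : Fin n → ℝ => ∏ i, gaussianPDF 0 v (x i / 2) :=
    Finset.measurable_prod _ fun i _ => (measurable_gaussianPDF 0 v).comp (by fun_prop)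
  have hhalf : ∫⁻ x : ℝ, gaussianPDF 0 v (x / 2) = 2 := by
    have h4 : (4 : ℝ≥0) * v ≠ 0 := mul_ne_zero (by norm_num) hv
    have : ∀ x, gaussianPDF 0 v (x / 2) = 2 * gaussianPDF 0 (4 * v) x := by
      intro x
      have := gaussianPDFReal_inv_mul (μ := 0) (v := v) (c := 2) (by norm_num) x
      rw [gaussianPDF, gaussianPDF, div_eq_inv_mul, this, ENNReal.ofReal_mul (by positivity)]
      congr
      · norm_num
      · norm_num
      · push_cast; norm_num
    simp only [this]
    rw [lintegral_const_mul _ (measurable_gaussianPDF _ _), lintegral_gaussianPDF_eq_one 0 h4,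
      mul_one]
  have key := prekopa_leindler (n := n)
    (f := A.indicator fun x => ∏ i, gaussianPDF 0 v (x i))
    (g := B.indicator fun x => ∏ i, gaussianPDF 0 v (x i))
    (h := fun x => ENNReal.ofReal (Real.exp (-R / (8 * v))) * ∏ i, gaussianPDF 0 v (x i / 2))
    (hm.indicator hA) (hm.indicator hB) (hm2.const_mul _) (fun x y => by
      by_cases hx : x ∈ A
      swap
      · simp [Set.indicator_of_notMem hx]
      by_cases hy : y ∈ B
      swap
      · simp [Set.indicator_of_notMem hy]
      rw [Set.indicator_of_mem hx, Set.indicator_of_mem hy, prod_gaussianPDF, prod_gaussianPDF]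
      have e : ∏ i, gaussianPDF 0 v ((x + y) i / 2)
          = ∏ i, gaussianPDF 0 v (((1 / 2 : ℝ) • (x + y)) i) :=
        Finset.prod_congr rfl fun i _ => by congr 1; simp; ring
      rw [e, prod_gaussianPDF, ← ENNReal.ofReal_mul (by positivity),
        ← ENNReal.ofReal_mul (by positivity), ← ENNReal.ofReal_pow (by positivity)]
      refine ENNReal.ofReal_le_ofReal ?_
      have hR := h x hx y hy
      rw [l2Norm_sub_sq] at hR
      rw [l2Norm_smul_sq, l2Norm_add_sq]
      rw [mul_mul_mul_comm, ← Real.exp_add, mul_pow, mul_pow, ← Real.exp_nat_mul,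
        ← Real.exp_nat_mul, mul_left_comm, ← sq, ← Real.exp_add]
      refine mul_le_mul_of_nonneg_left (Real.exp_le_exp.2 ?_) (by positivity)
      push_cast
      rw [← sub_nonneg]
      have : 2 * (-R / (8 * (v : ℝ))) + 2 * (-((1 / 2) ^ 2 * (l2Norm x ^ 2 + 2 * (x ⬝ᵥ y)
          + l2Norm y ^ 2)) / (2 * v)) - (-l2Norm x ^ 2 / (2 * v) + -l2Norm y ^ 2 / (2 * v))
          = (l2Norm x ^ 2 - 2 * (x ⬝ᵥ y) + l2Norm y ^ 2 - R) / (4 * v) := by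
        field_simp
        ring
      rw [this]
      exact div_nonneg (by linarith) (by positivity))
  rw [lintegral_indicator hA, lintegral_indicator hB, ← withDensity_apply _ hA,
    ← withDensity_apply _ hB, ← gaussianPi_eq_withDensity n hv, lintegral_const_mul _ hm2,
    lintegral_prod_fin (f := fun _ x => gaussianPDF 0 v (x / 2))
      fun i => (measurable_gaussianPDF 0 v).comp (by fun_prop), hhalf, mul_pow,
    ← ENNReal.ofReal_pow (by positivity), ← Real.exp_nat_mul] at key
  have e4 : (∏ _i : Fin n, (2 : ℝ≥0∞)) ^ 2 = 4 ^ n := by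
    rw [Finset.prod_const, Finset.card_univ, Fintype.card_fin, ← pow_mul, mul_comm n 2, pow_mul]
    norm_num
  rw [e4, mul_comm] at key
  have h4 : (4 : ℝ≥0∞) ^ n ≠ 0 := pow_ne_zero _ (by norm_num)
  have h4t : (4 : ℝ≥0∞) ^ n ≠ ∞ := ENNReal.pow_ne_top (by norm_num)
  have := (ENNReal.mul_le_mul_iff_left h4 h4t).1 key
  refine this.trans (le_of_eq ?_)
  congr 2
  push_cast
  ring

/-- Shifting a set of noise vectors against a direction `a` along which all its elements are
large increases its Gaussian measure exponentially. -/
lemma gaussianPi_shift_le {n : ℕ} {v : ℝ≥0} (hv : v ≠ 0) {E F : Set (Fin n → ℝ)}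
    (hE : MeasurableSet E) (hF : MeasurableSet F) {a : Fin n → ℝ} {s U : ℝ} (hs : 0 ≤ s)
    (hU : ∀ x ∈ E, U ≤ a ⬝ᵥ x) (hEF : ∀ x ∈ E, x - s • a ∈ F) :
    (gaussianPi n v).real E
      ≤ Real.exp (-(s * U - s ^ 2 * l2Norm a ^ 2 / 2) / v) * (gaussianPi n v).real F := by
  have hvpos : (0 : ℝ) < v := by positivity
  have hm : Measurable fun x : Fin n → ℝ => ∏ i, gaussianPDF 0 v (x i) :=
    Finset.measurable_prod _ fun i _ => (measurable_gaussianPDF 0 v).comp (measurable_pi_apply i)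
  set c := Real.exp (-(s * U - s ^ 2 * l2Norm a ^ 2 / 2) / v) with hc
  have key : gaussianPi n v E ≤ ENNReal.ofReal c * gaussianPi n v F := by
    rw [gaussianPi_eq_withDensity n hv, withDensity_apply _ hE, withDensity_apply _ hF,
      ← lintegral_indicator hE, ← lintegral_indicator hF, ← lintegral_const_mul _ (hm.indicator hF),
      ← lintegral_add_right_eq_self _ (s • a)]
    refine lintegral_mono fun z => ?_
    by_cases hz : z + s • a ∈ E
    swap
    · simp [Set.indicator_of_notMem hz]
    have hzF : z ∈ F := by simpa using hEF _ hz
    rw [Set.indicator_of_mem hz, Set.indicator_of_mem hzF, prod_gaussianPDF, prod_gaussianPDF,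
      ← ENNReal.ofReal_mul (by positivity)]
    refine ENNReal.ofReal_le_ofReal ?_
    rw [mul_left_comm, hc, ← Real.exp_add]
    refine mul_le_mul_of_nonneg_left (Real.exp_le_exp.2 ?_) (by positivity)
    have h1 := hU _ hz
    rw [dotProduct_add, dotProduct_smul, ← l2Norm_sq_eq_dotProduct, smul_eq_mul,
      dotProduct_comm] at h1
    rw [l2Norm_add_sq, l2Norm_smul_sq, dotProduct_smul, smul_eq_mul, ← sub_nonneg]
    have : -(s * U - s ^ 2 * l2Norm a ^ 2 / 2) / (v : ℝ) + -l2Norm z ^ 2 / (2 * v)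
        - -(l2Norm z ^ 2 + 2 * (s * (z ⬝ᵥ a)) + s ^ 2 * l2Norm a ^ 2) / (2 * v)
        = s * (z ⬝ᵥ a + s * l2Norm a ^ 2 - U) / v := by
      field_simp
      ring
    rw [this]
    exact div_nonneg (mul_nonneg hs (by linarith)) hvpos.le
  have := ENNReal.toReal_mono (by finiteness) key
  rwa [ENNReal.toReal_mul, ENNReal.toReal_ofReal (Real.exp_pos _).le] at this

lemma measurable_dotProduct_left {n : ℕ} (a : Fin n → ℝ) :
    Measurable fun x : Fin n → ℝ => a ⬝ᵥ x := by
  unfold dotProduct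
  fun_prop

/-- The two-sided Gaussian tail bound, without the usual factor `2`: both tails are shifted to
disjoint half-spaces. -/
lemma gaussianPi_tail_le {n : ℕ} {v : ℝ≥0} (hv : v ≠ 0) {a : Fin n → ℝ} {m : ℝ} (hm : 0 < m)
    (ha : l2Norm a ^ 2 = m) {t : ℝ} (ht : 0 ≤ t) :
    (gaussianPi n v).real {x | t < |a ⬝ᵥ x|} ≤ Real.exp (-t ^ 2 / (2 * v * m)) := by
  have hvpos : (0 : ℝ) < v := by positivity
  have hma := measurable_dotProduct_left a
  have hself : a ⬝ᵥ a = m := by rw [← l2Norm_sq_eq_dotProduct, ha]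
  have hexp :
      -(t / m * t - (t / m) ^ 2 * m / 2) / v = -t ^ 2 / (2 * v * m) := by
    field_simp
    ring
  have e1 := gaussianPi_shift_le (v := v) hv (E := {x | t < a ⬝ᵥ x}) (F := {x | 0 < a ⬝ᵥ x})
    (a := a) (s := t / m) (U := t) (measurableSet_lt measurable_const hma)
    (measurableSet_lt measurable_const hma) (by positivity) (fun x hx => le_of_lt hx)
    (fun x (hx : t < a ⬝ᵥ x) => by
      simp only [Set.mem_ofPred_eq, dotProduct_sub, dotProduct_smul, smul_eq_mul, hself]
      rw [div_mul_cancel₀ _ hm.ne']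
      linarith)
  have e2 := gaussianPi_shift_le (v := v) hv (E := {x | t < -(a ⬝ᵥ x)}) (F := {x | a ⬝ᵥ x < 0})
    (a := -a) (s := t / m) (U := t) (measurableSet_lt measurable_const hma.neg)
    (measurableSet_lt hma measurable_const) (by positivity)
    (fun x (hx : t < -(a ⬝ᵥ x)) => by rw [neg_dotProduct]; exact hx.le)
    (fun x (hx : t < -(a ⬝ᵥ x)) => by
      simp only [Set.mem_ofPred_eq, dotProduct_sub, dotProduct_smul, smul_eq_mul, dotProduct_neg,
        hself]
      have : t / m * m = t := div_mul_cancel₀ _ hm.ne'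
      linarith)
  have hneg : l2Norm (-a) ^ 2 = m := by
    rw [l2Norm_sq_eq_dotProduct, neg_dotProduct, dotProduct_neg, neg_neg, hself]
  rw [hneg, hexp] at e2
  rw [ha, hexp] at e1
  have hdisj : (gaussianPi n v).real {x | 0 < a ⬝ᵥ x} + (gaussianPi n v).real {x | a ⬝ᵥ x < 0}
      ≤ 1 := by
    rw [← measureReal_union _ (measurableSet_lt hma measurable_const)]
    · exact measureReal_le_one
    · exact Set.disjoint_left.2 fun x (h1 : 0 < a ⬝ᵥ x) (h2 : a ⬝ᵥ x < 0) => lt_asymm h1 h2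
  have hunion : {x | t < |a ⬝ᵥ x|} = {x | t < a ⬝ᵥ x} ∪ {x | t < -(a ⬝ᵥ x)} := by
    ext x; simp [lt_abs]
  rw [hunion]
  refine (measureReal_union_le _ _).trans ((add_le_add e1 e2).trans ?_)
  rw [← mul_add]
  exact mul_le_of_le_one_right (Real.exp_pos _).le hdisj

/-! ### Active sets and shifts of Lasso solutions -/

section Lasso

variable {n p : ℕ} (X : Matrix (Fin n) (Fin p) ℝ)

lemma exists_pos_le_abs_on_supp (b : Fin p → ℝ) : ∃ m > 0, ∀ j ∈ supp b, m ≤ |b j| := by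
  rcases (supp b).eq_empty_or_nonempty with h | h
  · exact ⟨1, one_pos, by simp [h]⟩
  · obtain ⟨i, hi, hmin⟩ := Finset.exists_min_image (supp b) (fun j => |b j|) h
    exact ⟨|b i|, abs_pos.2 (mem_supp.1 hi), hmin⟩

/-- A unique minimizer has at most `n` nonzero entries: along a linear relation between the active
columns the objective would be affine near the minimizer. -/
lemma card_supp_le_of_isArgMin {y : Fin n → ℝ} {w b : Fin p → ℝ}
    (h : IsArgMin (penObj X y w) Set.univ b) : (supp b).card ≤ n := by
  by_contra! hcard
  have hdep : ¬ LinearIndependent ℝ (fun j : supp b => fun i => X i j) := fun hli => by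
    have := hli.fintype_card_le_finrank
    simp only [Fintype.card_coe, Module.finrank_fin_fun] at this
    omega
  obtain ⟨g, hg, i₀, hi₀⟩ := Fintype.not_linearIndependent_iff.1 hdep
  set d : Fin p → ℝ := fun j => if hj : j ∈ supp b then g ⟨j, hj⟩ else 0 with hd
  have hXd : X *ᵥ d = 0 := by
    ext i
    have := congrFun hg i
    simp only [Finset.sum_apply, Pi.smul_apply, smul_eq_mul, Pi.zero_apply] at this
    rw [Pi.zero_apply, ← this, Matrix.mulVec, dotProduct,
      ← Finset.sum_subset (Finset.subset_univ (supp b)), ← Finset.sum_coe_sort]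
    · refine Finset.sum_congr rfl fun j _ => ?_
      simp [hd, mul_comm]
    · intro j _ hj
      simp [hd, hj]
  obtain ⟨m, hm, hmb⟩ := exists_pos_le_abs_on_supp b
  have hS : 0 ≤ ∑ j, |d j| := Finset.sum_nonneg fun j _ => abs_nonneg _
  set t := m / (1 + ∑ j, |d j|) with ht
  have htpos : 0 < t := div_pos hm (by linarith)
  have htd : ∀ j, |t * d j| ≤ |b j| := by
    intro j
    by_cases hj : j ∈ supp b
    · have h1 : |d j| ≤ 1 + ∑ j, |d j| := by
        linarith [Finset.single_le_sum (f := fun j => |d j|) (fun j _ => abs_nonneg _)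
          (Finset.mem_univ j)]
      rw [abs_mul, abs_of_pos htpos]
      calc t * |d j| ≤ t * (1 + ∑ j, |d j|) := by gcongr
        _ = m := div_mul_cancel₀ _ (by linarith)
        _ ≤ |b j| := hmb j hj
    · simp [hd, hj]
  have hne : t • d ≠ 0 := by
    intro h0
    have := congrFun h0 i₀
    simp only [Pi.smul_apply, smul_eq_mul, Pi.zero_apply, mul_eq_zero, htpos.ne', false_or] at this
    exact hi₀ (by simpa [hd] using this)
  have habs : ∀ j, |b j + t * d j| + |b j - t * d j| = 2 * |b j| := by
    intro j
    have := abs_le.1 (htd j)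
    rcases le_total 0 (b j) with hb | hb
    · rw [abs_of_nonneg hb] at this ⊢
      rw [abs_of_nonneg (by linarith), abs_of_nonneg (by linarith)]; ring
    · rw [abs_of_nonpos hb] at this ⊢
      rw [abs_of_nonpos (by linarith), abs_of_nonpos (by linarith)]; ring
  have h1 := h.2 (b + t • d) trivial (by simpa using hne)
  have h2 := h.2 (b - t • d) trivial (by simpa using hne)
  rw [penObj_eq_add X y w b (b + t • d)] at h1
  rw [penObj_eq_add X y w b (b - t • d)] at h2
  have e1 : X *ᵥ (b + t • d - b) = 0 := by
    rw [add_sub_cancel_left, Matrix.mulVec_smul, hXd, smul_zero]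
  have e2 : X *ᵥ (b - t • d - b) = 0 := by
    rw [sub_sub_cancel_left, Matrix.mulVec_neg, Matrix.mulVec_smul, hXd, smul_zero, neg_zero]
  have e0 : l2Norm (0 : Fin n → ℝ) ^ 2 = 0 := by simp [l2Norm_sq]
  rw [e1, e0, dotProduct_zero] at h1
  rw [e2, e0, dotProduct_zero] at h2
  have e3 : ∑ j, w j * |(b + t • d) j| + ∑ j, w j * |(b - t • d) j| = 2 * ∑ j, w j * |b j| := by
    rw [← Finset.sum_add_distrib, Finset.mul_sum]
    refine Finset.sum_congr rfl fun j _ => ?_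
    rw [← mul_add]
    have := habs j
    simp only [Pi.add_apply, Pi.sub_apply, Pi.smul_apply, smul_eq_mul]
    rw [this]
    ring
  linarith

/-- The noise vectors for which some Lasso solution has `j`-th entry at least `s` in the
direction of the sign `τ`. -/
def largeEntrySet (β : Fin p → ℝ) (lam0 τ s : ℝ) (j : Fin p) : Set (Fin n → ℝ) :=
  {ε | ∃ b : Fin p → ℝ, (∀ z, penObj X (X *ᵥ β + ε) (fun _ => lam0) b
    ≤ penObj X (X *ᵥ β + ε) (fun _ => lam0) z) ∧ s ≤ τ * b j}

lemma continuous_l2Norm {ι : Type*} [Fintype ι] : Continuous (l2Norm : (ι → ℝ) → ℝ) :=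
  continuous_norm.comp (PiLp.continuous_toLp 2 _)

lemma tendsto_penObj (w : Fin p → ℝ) {y : ℕ → Fin n → ℝ} {y' : Fin n → ℝ}
    {b : ℕ → Fin p → ℝ} {b' : Fin p → ℝ} (hy : Tendsto y atTop (𝓝 y'))
    (hb : Tendsto b atTop (𝓝 b')) :
    Tendsto (fun k => penObj X (y k) w (b k)) atTop (𝓝 (penObj X y' w b')) := by
  unfold penObj
  have hX : Continuous fun v : Fin p → ℝ => X *ᵥ v :=
    Continuous.matrix_mulVec continuous_const continuous_id
  have h1 : Tendsto (fun k => y k - X *ᵥ b k) atTop (𝓝 (y' - X *ᵥ b')) :=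
    hy.sub ((hX.tendsto b').comp hb)
  have h2 : Tendsto (fun k => l2Norm (y k - X *ᵥ b k)) atTop (𝓝 (l2Norm (y' - X *ᵥ b'))) :=
    (continuous_l2Norm.tendsto _).comp h1
  have h3 : ∀ j, Tendsto (fun k => b k j) atTop (𝓝 (b' j)) := tendsto_pi_nhds.1 hb
  exact ((h2.pow 2).const_mul _).add (tendsto_finsetSum _ fun j _ => (h3 j).abs.const_mul _)

lemma isClosed_largeEntrySet (β : Fin p → ℝ) {lam0 : ℝ} (hlam : 0 < lam0) (τ s : ℝ) (j : Fin p) :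
    IsClosed (largeEntrySet X β lam0 τ s j) := by
  refine IsSeqClosed.isClosed fun x ε hx hε => ?_
  choose b hb hs using hx
  have hy : Tendsto (fun k => X *ᵥ β + x k) atTop (𝓝 (X *ᵥ β + ε)) := hε.const_add _
  -- comparison with the zero vector bounds the minimizers
  have hbound : ∀ k, lam0 * ‖b k‖ ≤ penObj X (X *ᵥ β + x k) (fun _ => lam0) 0 := by
    intro k
    refine le_trans ?_ (hb k 0)
    unfold penObj
    rw [← Finset.mul_sum]
    have h1 : ‖b k‖ ≤ ∑ i, |b k i| := by
      refine (pi_norm_le_iff_of_nonneg (Finset.sum_nonneg fun i _ => abs_nonneg _)).2 fun i => ?_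
      exact Finset.single_le_sum (f := fun i => |b k i|) (fun i _ => abs_nonneg _)
        (Finset.mem_univ i)
    nlinarith [sq_nonneg (l2Norm (X *ᵥ β + x k - X *ᵥ b k)), mul_le_mul_of_nonneg_left h1 hlam.le]
  have hlim0 : Tendsto (fun k => penObj X (X *ᵥ β + x k) (fun _ => lam0) 0) atTop
      (𝓝 (penObj X (X *ᵥ β + ε) (fun _ => lam0) 0)) :=
    tendsto_penObj X _ hy tendsto_const_nhds
  obtain ⟨M, hM⟩ := hlim0.bddAbove_range
  have hball : ∀ k, b k ∈ Metric.closedBall (0 : Fin p → ℝ) (M / lam0) := fun k => by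
    rw [mem_closedBall_zero_iff, le_div_iff₀ hlam, mul_comm]
    exact (hbound k).trans (hM ⟨k, rfl⟩)
  obtain ⟨b', -, φ, hφ, hlim⟩ := tendsto_subseq_of_bounded Metric.isBounded_closedBall hball
  refine ⟨b', fun z => ?_, ?_⟩
  · have hy' := hy.comp hφ.tendsto_atTop
    exact le_of_tendsto_of_tendsto' (tendsto_penObj X _ hy' hlim)
      (tendsto_penObj X _ hy' tendsto_const_nhds) fun k => hb (φ k) z
  · have : Tendsto (fun k => τ * b (φ k) j) atTop (𝓝 (τ * b' j)) :=
      ((tendsto_pi_nhds.1 hlim j).const_mul τ)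
    exact ge_of_tendsto' this fun k => hs (φ k)

/-- The subgradient condition of the Lasso at a single coordinate. -/
lemma coordinate_variational {y : Fin n → ℝ} {lam0 : ℝ} (hlam : 0 ≤ lam0) {b : Fin p → ℝ}
    (hb : ∀ z, penObj X y (fun _ => lam0) b ≤ penObj X y (fun _ => lam0) z) (j : Fin p) (t : ℝ) :
    (Xᵀ *ᵥ (y - X *ᵥ b)) j * (t - b j) ≤ lam0 * |t| - lam0 * |b j| := by
  have h := variational_inequality X (w := fun _ => lam0) convex_univ (fun _ => hlam)
    (Set.mem_univ b) (fun v _ => hb v) (Set.mem_univ (b + Pi.single j (t - b j)))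
  rw [add_sub_cancel_left, dotProduct_mulVec_eq, dotProduct_single,
    ← Finset.sum_sub_distrib, Finset.sum_eq_single j] at h
  · simpa using h
  · intro i _ hi
    simp [hi]
  · simp

/-- Subtracting `s τ' X_j` from the noise subtracts `s τ'` from the `j`-th entry of the Lasso
solution, provided that entry does not change sign: the residual, hence the optimality condition,
is the same. -/
lemma sub_smul_col_mem_largeEntrySet {β : Fin p → ℝ} {lam0 τ τ' s : ℝ} (hlam : 0 ≤ lam0)
    (hτ : τ = 1 ∨ τ = -1) (hτ' : τ' = 1 ∨ τ' = -1) (hs : 0 < s) {j : Fin p} {ε : Fin n → ℝ}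
    (h : ε ∈ largeEntrySet X β lam0 τ (2 * s) j) :
    ε - s • (τ' • fun i => X i j) ∈ largeEntrySet X β lam0 τ s j := by
  obtain ⟨b, hb, hbs⟩ := h
  set e : Fin p → ℝ := Pi.single j (s * τ') with he
  have hXe : X *ᵥ e = s • (τ' • fun i => X i j) := by
    ext i
    simp [he, Matrix.mulVec_single, mul_comm, mul_left_comm]
  have hττ : s ≤ τ * (b - e) j := by
    simp only [he, Pi.sub_apply, Pi.single_eq_same]
    rcases hτ with rfl | rfl <;> rcases hτ' with rfl | rfl <;> linarith
  refine ⟨b - e, fun z => penObj_le_of_variational X ?_, hττ⟩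
  have e1 : X *ᵥ β + (ε - s • (τ' • fun i => X i j)) - X *ᵥ (b - e)
      = X *ᵥ β + ε - X *ᵥ b := by
    rw [Matrix.mulVec_sub, hXe]; abel
  have hcoord := coordinate_variational X hlam hb
  rw [e1, dotProduct_mulVec_eq, dotProduct, ← Finset.sum_sub_distrib]
  set g := Xᵀ *ᵥ (X *ᵥ β + ε - X *ᵥ b)
  refine Finset.sum_le_sum fun i _ => ?_
  rcases eq_or_ne i j with rfl | hne
  · -- the entry is active, so its subgradient is determined
    have h0 := hcoord i 0
    have h2 := hcoord i (2 * b i)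
    rw [abs_mul, abs_two] at h2
    rw [abs_zero] at h0
    rw [Pi.sub_apply]
    rcases hτ with rfl | rfl
    · have hg : g i = lam0 := by
        rw [abs_of_pos (by linarith)] at h0 h2
        have hbi : 0 < b i := by linarith
        nlinarith
      rw [hg, abs_of_pos (a := (b - e) i) (by linarith)]
      nlinarith [le_abs_self (z i)]
    · have hg : g i = -lam0 := by
        rw [abs_of_neg (by linarith)] at h0 h2
        have hbi : b i < 0 := by linarith
        nlinarith
      rw [hg, abs_of_neg (a := (b - e) i) (by linarith)]
      nlinarith [neg_abs_le (z i)]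
  · have : (b - e) i = b i := by simp [he, hne]
    rw [Pi.sub_apply, this]
    exact hcoord i (z i)

/-- If the Lasso solution is unique, at most `n` of the sets `largeEntrySet` contain the noise. -/
lemma sum_indicator_largeEntrySet_le {β : Fin p → ℝ} {lam0 τ s : ℝ} (hs : 0 < s)
    {ε : Fin n → ℝ} {b : Fin p → ℝ} (hb : IsArgMin (lassoObj X (X *ᵥ β + ε) lam0) Set.univ b) :
    ∑ j, (largeEntrySet X β lam0 τ s j).indicator (1 : (Fin n → ℝ) → ℝ≥0∞) ε ≤ n := by
  have hb' : IsArgMin (penObj X (X *ᵥ β + ε) fun _ => lam0) Set.univ b := by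
    refine ⟨trivial, fun v hv hne => ?_⟩
    rw [← lassoObj_eq_penObj, ← lassoObj_eq_penObj]
    exact hb.2 v hv hne
  calc ∑ j, (largeEntrySet X β lam0 τ s j).indicator (1 : (Fin n → ℝ) → ℝ≥0∞) ε
      ≤ ∑ j, if j ∈ supp b then (1 : ℝ≥0∞) else 0 := by
        refine Finset.sum_le_sum fun j _ => ?_
        by_cases hj : ε ∈ largeEntrySet X β lam0 τ s j
        swap
        · simp [Set.indicator_of_notMem hj]
        obtain ⟨b', hmin, hbs⟩ := hj
        have hbb : b' = b := by
          by_contra hne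
          exact absurd (hb'.2 b' trivial hne) (not_lt.2 (hmin b))
        have : j ∈ supp b := mem_supp.2 fun h0 => by
          rw [hbb, h0, mul_zero] at hbs
          exact absurd hbs (not_le.2 hs)
        rw [if_pos this]
        exact Set.indicator_le_self' (by simp) _ |>.trans (by simp)
    _ = ((supp b).card : ℝ≥0∞) := by simp
    _ ≤ n := by exact_mod_cast card_supp_le_of_isArgMin X hb'

/-- It is exponentially unlikely that some entry of the Lasso solution is large while the
corresponding column is strongly correlated with the noise. The bound has the factor `n` and not
the possibly far larger `p`: after the shift of the noise, the `p` events overlap at most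
`n`-fold. -/
lemma measureReal_largeEntry_le {X : Matrix (Fin n) (Fin p) ℝ} (hX : Standardized X) (hn : 0 < n)
    {v : ℝ≥0} (hv : v ≠ 0) (β : Fin p → ℝ) {lam0 τ τ' s U : ℝ} (hlam : 0 < lam0)
    (hτ : τ = 1 ∨ τ = -1) (hτ' : τ' = 1 ∨ τ' = -1) (hs : 0 < s)
    (hae : ∀ᵐ ε ∂gaussianPi n v,
      ∑ j, (largeEntrySet X β lam0 τ s j).indicator (1 : (Fin n → ℝ) → ℝ≥0∞) ε ≤ n) :
    (gaussianPi n v).real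
        (⋃ j, largeEntrySet X β lam0 τ (2 * s) j ∩ {ε | U ≤ τ' * (Xᵀ *ᵥ ε) j})
      ≤ Real.exp (-(s * U - s ^ 2 * n / 2) / v) * n := by
  have hF := fun j => (isClosed_largeEntrySet X β hlam τ s j).measurableSet
  have hE : ∀ j, MeasurableSet
      (largeEntrySet X β lam0 τ (2 * s) j ∩ {ε | U ≤ τ' * (Xᵀ *ᵥ ε) j}) := fun j =>
    (isClosed_largeEntrySet X β hlam τ (2 * s) j).measurableSet.inter
      (measurableSet_le measurable_const
        ((measurable_dotProduct_left fun i => X i j).const_mul τ'))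
  have hsum : ∑ j, (gaussianPi n v).real (largeEntrySet X β lam0 τ s j) ≤ n := by
    have h1 : ∑ j, gaussianPi n v (largeEntrySet X β lam0 τ s j) ≤ n := by
      calc ∑ j, gaussianPi n v (largeEntrySet X β lam0 τ s j)
          = ∑ j, ∫⁻ ε, (largeEntrySet X β lam0 τ s j).indicator 1 ε ∂gaussianPi n v :=
            Finset.sum_congr rfl fun j _ => (lintegral_indicator_one (hF j)).symm
        _ = ∫⁻ ε, ∑ j, (largeEntrySet X β lam0 τ s j).indicator 1 ε ∂gaussianPi n v :=
            (lintegral_finsetSum _ fun j _ => measurable_one.indicator (hF j)).symm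
        _ ≤ ∫⁻ _, (n : ℝ≥0∞) ∂gaussianPi n v := lintegral_mono_ae hae
        _ = n := by simp
    have h2 := ENNReal.toReal_mono (ENNReal.natCast_ne_top n) h1
    rwa [ENNReal.toReal_sum fun j _ => measure_ne_top _ _, ENNReal.toReal_natCast] at h2
  have hnorm : ∀ j, l2Norm (τ' • fun i => X i j) ^ 2 = n := fun j => by
    have : τ' ^ 2 = 1 := by rcases hτ' with rfl | rfl <;> norm_num
    rw [l2Norm_smul_sq, this, one_mul, l2Norm_sq_eq_dotProduct, col_dotProduct_self hX hn]
  calc (gaussianPi n v).real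
        (⋃ j, largeEntrySet X β lam0 τ (2 * s) j ∩ {ε | U ≤ τ' * (Xᵀ *ᵥ ε) j})
      ≤ ∑ j, (gaussianPi n v).real
          (largeEntrySet X β lam0 τ (2 * s) j ∩ {ε | U ≤ τ' * (Xᵀ *ᵥ ε) j}) :=
        measureReal_iUnion_fintype_le _
    _ ≤ ∑ j, Real.exp (-(s * U - s ^ 2 * n / 2) / v)
          * (gaussianPi n v).real (largeEntrySet X β lam0 τ s j) := by
        refine Finset.sum_le_sum fun j _ => ?_
        have := gaussianPi_shift_le hv (hE j) (hF j) (a := τ' • fun i => X i j) (s := s) (U := U)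
          hs.le (fun ε hε => by rw [smul_dotProduct]; exact hε.2)
          (fun ε hε => sub_smul_col_mem_largeEntrySet X hlam.le hτ hτ' hs hε.1)
        rwa [hnorm j] at this
    _ ≤ _ := by
        rw [← Finset.mul_sum]
        exact mul_le_mul_of_nonneg_left hsum (Real.exp_pos _).le

end Lasso

/-! ### The favourable noise vectors -/

section Noise

variable {n p : ℕ} {X : Matrix (Fin n) (Fin p) ℝ}

lemma measureReal_score_gt_le (hX : Standardized X) (hn : 0 < n) {v : ℝ≥0} (hv : v ≠ 0)
    (T : Finset (Fin p)) {t : ℝ} (ht : 0 ≤ t) :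
    (gaussianPi n v).real (⋃ j ∈ T, {ε | t < |(Xᵀ *ᵥ ε) j|})
      ≤ T.card * Real.exp (-t ^ 2 / (2 * v * n)) := by
  refine (measureReal_biUnion_finset_le _ _).trans ?_
  rw [← nsmul_eq_mul]
  refine Finset.sum_le_card_nsmul _ _ _ fun j _ => ?_
  exact gaussianPi_tail_le hv (a := fun i => X i j) (by positivity)
    (by rw [l2Norm_sq_eq_dotProduct, col_dotProduct_self hX hn]) ht

lemma continuous_transpose_mulVec_apply (X : Matrix (Fin n) (Fin p) ℝ) (j : Fin p) :
    Continuous fun ε : Fin n → ℝ => (Xᵀ *ᵥ ε) j :=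
  (continuous_apply j).comp (Continuous.matrix_mulVec continuous_const continuous_id)

/-- The noise vectors whose correlations with all columns are at most `t`. -/
def smallScoreSet (X : Matrix (Fin n) (Fin p) ℝ) (t : ℝ) : Set (Fin n → ℝ) :=
  {ε | ∀ j, |(Xᵀ *ᵥ ε) j| ≤ t}

lemma isClosed_smallScoreSet (X : Matrix (Fin n) (Fin p) ℝ) (t : ℝ) :
    IsClosed (smallScoreSet X t) := by
  rw [smallScoreSet, Set.ofPred_forall]
  exact isClosed_iInter fun j =>
    isClosed_le (continuous_transpose_mulVec_apply X j).abs continuous_const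

/-- The noise vectors within Euclidean distance `√R` of `A`. -/
def nearSet (A : Set (Fin n → ℝ)) (R : ℝ) : Set (Fin n → ℝ) :=
  {ε | ∃ ε' ∈ A, l2Norm (ε - ε') ^ 2 ≤ R}

lemma isClosed_nearSet {A : Set (Fin n → ℝ)} (hA : IsClosed A) (R : ℝ) :
    IsClosed (nearSet A R) := by
  have hball : IsCompact {x : Fin n → ℝ | l2Norm x ^ 2 ≤ R} := by
    refine Metric.isCompact_of_isClosed_isBounded
      (isClosed_le (continuous_l2Norm.pow 2) continuous_const) ?_
    refine (Metric.isBounded_closedBall (x := (0 : Fin n → ℝ)) (r := √R)).subset fun x hx => ?_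
    rw [mem_closedBall_zero_iff]
    exact (norm_le_l2Norm x).trans (Real.le_sqrt_of_sq_le hx)
  convert hA.add_right_of_isCompact hball using 1
  ext ε
  simp only [nearSet, Set.mem_ofPred_eq, Set.mem_add]
  constructor
  · rintro ⟨a, ha, h⟩
    exact ⟨a, ha, ε - a, h, by abel⟩
  · rintro ⟨a, ha, x, hx, rfl⟩
    exact ⟨a, ha, by simpa using hx⟩

/-- A union bound over all columns. The level `7/4` has the exponent `(7/4)² / 2 > 3/2`, which
outweighs the number `p` of columns, and it is `7/16` of the Lasso penalty level, less than the
usual `1/2`. The slack serves to absorb the distance to a weakly correlated vector. -/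
lemma measureReal_smallScoreSet_compl_le (hX : Standardized X) (hn : 0 < n) (hp : 0 < p)
    {v : ℝ≥0} (hv : v ≠ 0) {t : ℝ} (ht : t = 7 / 4 * √(v * n * Real.log p)) :
    (gaussianPi n v).real (smallScoreSet X t)ᶜ ≤ Real.exp (-(Real.log p / 2)) := by
  have hn' : (0 : ℝ) < n := by positivity
  have hv' : (0 : ℝ) < v := by positivity
  have hlog : 0 ≤ Real.log p := Real.log_natCast_nonneg p
  have ht0 : 0 ≤ t := by rw [ht]; positivity
  have e : (smallScoreSet X t)ᶜ =
      ⋃ j ∈ (Finset.univ : Finset (Fin p)), {ε | t < |(Xᵀ *ᵥ ε) j|} := by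
    ext ε; simp [smallScoreSet]
  rw [e]
  refine (measureReal_score_gt_le hX hn hv Finset.univ ht0).trans ?_
  have e2 : -t ^ 2 / (2 * v * n) = -(49 / 32 * Real.log p) := by
    rw [ht, mul_pow, Real.sq_sqrt (by positivity)]
    field_simp
    ring
  rw [e2, Finset.card_univ, Fintype.card_fin]
  nth_rw 1 [← Real.exp_log (show (0 : ℝ) < p by positivity)]
  rw [← Real.exp_add]
  exact Real.exp_le_exp.2 (by linarith)

lemma exp_neg_nat_mul_log {n : ℕ} (hn : 0 < n) (k : ℕ) :
    Real.exp (-(k * Real.log n)) = 1 / (n : ℝ) ^ k := by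
  rw [Real.exp_neg, Real.exp_nat_mul, Real.exp_log (by positivity), one_div]

/-- With high probability the noise is close to a vector that is weakly correlated with all
columns, by Gaussian concentration. For `p` small compared with `n`, the noise itself need not be
weakly correlated with all columns, relative to the Lasso penalty level, with probability
`1 - 1 / n`. -/
lemma measureReal_nearSet_compl_le (hX : Standardized X) (hn : 0 < n) (hp : 2 ≤ p)
    {v : ℝ≥0} (hv : v ≠ 0) {t : ℝ} (ht : t = 7 / 4 * √(v * n * Real.log p)) :
    (gaussianPi n v).real (nearSet (smallScoreSet X t) (12 * v * Real.log n))ᶜ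
      ≤ 4 / (n : ℝ) ^ 3 := by
  have hv' : (0 : ℝ) < v := by positivity
  set A := smallScoreSet X t
  have hA : IsClosed A := isClosed_smallScoreSet X t
  set B := (nearSet A (12 * v * Real.log n))ᶜ
  have hquarter : 1 / 4 ≤ (gaussianPi n v).real A := by
    have h1 := measureReal_smallScoreSet_compl_le hX hn (by omega) hv ht
    have h2 : Real.exp (-(Real.log p / 2)) ≤ 3 / 4 := by
      have hlog : Real.log 2 ≤ Real.log p := Real.log_le_log (by norm_num) (by exact_mod_cast hp)
      have h3 : Real.exp (-(Real.log p / 2)) ≤ Real.exp (-(Real.log 2 / 2)) :=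
        Real.exp_le_exp.2 (by linarith)
      refine h3.trans ?_
      have h4 : Real.exp (-(Real.log 2 / 2)) ^ 2 = 1 / 2 := by
        rw [← Real.exp_nat_mul]
        push_cast
        rw [show (2 : ℝ) * -(Real.log 2 / 2) = -Real.log 2 by ring, Real.exp_neg,
          Real.exp_log (by norm_num), one_div]
      nlinarith [Real.exp_pos (-(Real.log 2 / 2))]
    have h5 := probReal_compl_eq_one_sub (μ := gaussianPi n v) hA.measurableSet
    linarith
  have key := gaussianPi_mul_le (n := n) hv hA.measurableSet
    (isClosed_nearSet hA (12 * v * Real.log n)).measurableSet.compl (R := 12 * v * Real.log n)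
    (fun x hx y hy => by
      by_contra! hlt
      refine hy ⟨x, hx, ?_⟩
      rw [l2Norm_sub_sq, dotProduct_comm]
      rw [l2Norm_sub_sq] at hlt
      linarith)
  have key' := ENNReal.toReal_mono ENNReal.ofReal_ne_top key
  rw [ENNReal.toReal_mul, ENNReal.toReal_ofReal (Real.exp_pos _).le] at key'
  have e : Real.exp (-(12 * v * Real.log n) / (4 * v)) = 1 / (n : ℝ) ^ 3 := by
    rw [← exp_neg_nat_mul_log hn 3]
    congr 1
    push_cast
    field_simp
    ring
  rw [e] at key'
  change (gaussianPi n v).real A * (gaussianPi n v).real B ≤ _ at key'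
  have hB : 0 ≤ (gaussianPi n v).real B := measureReal_nonneg
  have : 4 / (n : ℝ) ^ 3 = 4 * (1 / (n : ℝ) ^ 3) := by ring
  rw [this]
  nlinarith

/-- The conditions on the noise under which the analysis of the iterates is deterministic. Here
`T` is the set of columns whose correlation with the noise is controlled at the level of a union
bound over `n` variables; `s` and `U` are thresholds for an entry of the Lasso solution and for
the correlation of its column with the noise. The exponent in `n ^ 4 < p` is a convenient choice:
it makes the bound over all columns hold with probability much larger than `1 - 1 / n`. -/
structure FavourableNoise (X : Matrix (Fin n) (Fin p) ℝ) (β : Fin p → ℝ) (T : Finset (Fin p))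
    (lam0 σ s U : ℝ) (ε : Fin n → ℝ) : Prop where
  near : 2 ≤ p → ∃ ε', (∀ j, |(Xᵀ *ᵥ ε') j| ≤ 7 / 16 * lam0) ∧
    l2Norm (ε - ε') ^ 2 ≤ 12 * σ ^ 2 * Real.log n
  small : n ^ 4 < p → ∀ j, |(Xᵀ *ᵥ ε) j| ≤ 7 / 16 * lam0
  score : ∀ j ∈ T, |(Xᵀ *ᵥ ε) j| ≤ σ * √(6 * n * Real.log n)
  entry : n ^ 4 < p → ∀ τ τ' : ℝ, τ = 1 ∨ τ = -1 → τ' = 1 ∨ τ' = -1 → ∀ j,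
    ε ∈ largeEntrySet X β lam0 τ (2 * s) j → τ' * (Xᵀ *ᵥ ε) j < U

/-- The noise is favourable with probability at least `1 - 1 / n`. -/
lemma exists_measurableSet_favourableNoise (hX : Standardized X) (hn : 8 ≤ n) (β : Fin p → ℝ)
    {T : Finset (Fin p)} (hT : T.card ≤ n) {lam0 σ s U : ℝ} (hσ : 0 < σ)
    (hlam : lam0 = 4 * σ * √(n * Real.log p)) (hs : 0 < s)
    (hsU : 3 * σ ^ 2 * Real.log n ≤ s * U - s ^ 2 * n / 2)
    (hae : n ^ 4 < p → ∀ τ : ℝ, ∀ᵐ ε ∂gaussianPi n (σ ^ 2).toNNReal,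
      ∑ j, (largeEntrySet X β lam0 τ s j).indicator (1 : (Fin n → ℝ) → ℝ≥0∞) ε ≤ n) :
    ∃ G, MeasurableSet G ∧ 1 - 1 / (n : ℝ) ≤ (gaussianPi n (σ ^ 2).toNNReal).real G ∧
      ∀ ε ∈ G, FavourableNoise X β T lam0 σ s U ε := by
  have hn0 : 0 < n := by omega
  have hnR : (8 : ℝ) ≤ n := by exact_mod_cast hn
  have hlogn : 0 ≤ Real.log n := Real.log_natCast_nonneg n
  set v : ℝ≥0 := (σ ^ 2).toNNReal with hvdef
  have hvR : (v : ℝ) = σ ^ 2 := Real.coe_toNNReal _ (sq_nonneg σ)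
  have hv : v ≠ 0 := by
    rw [← NNReal.coe_ne_zero, hvR]; positivity
  have ht : 7 / 16 * lam0 = 7 / 4 * √(v * n * Real.log p) := by
    rw [hlam, hvR, mul_assoc (σ ^ 2), Real.sqrt_mul (sq_nonneg σ), Real.sqrt_sq hσ.le]
    ring
  have hA := isClosed_smallScoreSet X (7 / 16 * lam0)
  set γ := gaussianPi n v
  obtain ⟨B₁, mB₁, bB₁, hB₁⟩ : ∃ B₁, MeasurableSet B₁ ∧ γ.real B₁ ≤ 4 / (n : ℝ) ^ 3 ∧
      ∀ ε ∉ B₁, 2 ≤ p → ∃ ε', (∀ j, |(Xᵀ *ᵥ ε') j| ≤ 7 / 16 * lam0) ∧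
        l2Norm (ε - ε') ^ 2 ≤ 12 * σ ^ 2 * Real.log n := by
    by_cases hp : 2 ≤ p
    · refine ⟨_, (isClosed_nearSet hA _).measurableSet.compl,
        measureReal_nearSet_compl_le hX hn0 hp hv ht, fun ε hε _ => ?_⟩
      obtain ⟨ε', h1, h2⟩ := not_not.1 hε
      exact ⟨ε', h1, by rwa [hvR] at h2⟩
    · exact ⟨∅, .empty, by simp; positivity, fun ε _ h => absurd h hp⟩
  obtain ⟨B₂, mB₂, bB₂, hB₂⟩ : ∃ B₂, MeasurableSet B₂ ∧ γ.real B₂ ≤ 1 / (n : ℝ) ^ 2 ∧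
      ∀ ε ∉ B₂, n ^ 4 < p → ∀ j, |(Xᵀ *ᵥ ε) j| ≤ 7 / 16 * lam0 := by
    by_cases hp : n ^ 4 < p
    · refine ⟨_, hA.measurableSet.compl,
        (measureReal_smallScoreSet_compl_le hX hn0 (by omega) hv ht).trans ?_, fun ε hε _ =>
          not_not.1 hε⟩
      rw [← exp_neg_nat_mul_log hn0]
      refine Real.exp_le_exp.2 ?_
      have : Real.log ((n : ℝ) ^ 4) ≤ Real.log p :=
        Real.log_le_log (by positivity) (by exact_mod_cast hp.le)
      rw [Real.log_pow] at this
      push_cast at this ⊢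
      linarith
    · exact ⟨∅, .empty, by simp, fun ε _ h => absurd h hp⟩
  obtain ⟨B₃, mB₃, bB₃, hB₃⟩ : ∃ B₃, MeasurableSet B₃ ∧ γ.real B₃ ≤ 1 / (n : ℝ) ^ 2 ∧
      ∀ ε ∉ B₃, ∀ j ∈ T, |(Xᵀ *ᵥ ε) j| ≤ σ * √(6 * n * Real.log n) := by
    refine ⟨_, ?_, (measureReal_score_gt_le hX hn0 hv T
      (t := σ * √(6 * n * Real.log n)) (by positivity)).trans ?_, fun ε hε j hj => ?_⟩
    · exact T.measurableSet_biUnion fun j _ => measurableSet_lt measurable_const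
        (continuous_transpose_mulVec_apply X j).abs.measurable
    · have e : -(σ * √(6 * n * Real.log n)) ^ 2 / (2 * v * n) = -((3 : ℕ) * Real.log n) := by
        rw [mul_pow, Real.sq_sqrt (by positivity), hvR]
        field_simp
        push_cast
        ring
      rw [e, exp_neg_nat_mul_log hn0]
      calc (T.card : ℝ) * (1 / (n : ℝ) ^ 3) ≤ n * (1 / (n : ℝ) ^ 3) := by gcongr
        _ = 1 / (n : ℝ) ^ 2 := by field_simp
    · by_contra! hlt
      exact hε (Set.mem_biUnion hj hlt)
  have h4 : ∀ τ τ' : ℝ, τ = 1 ∨ τ = -1 → τ' = 1 ∨ τ' = -1 →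
      ∃ B, MeasurableSet B ∧ γ.real B ≤ 1 / (n : ℝ) ^ 2 ∧ ∀ ε ∉ B, n ^ 4 < p →
        ∀ j, ε ∈ largeEntrySet X β lam0 τ (2 * s) j → τ' * (Xᵀ *ᵥ ε) j < U := by
    intro τ τ' hτ hτ'
    by_cases hp : n ^ 4 < p
    · have hp2 : 1 < p := lt_of_le_of_lt (Nat.one_le_pow 4 n hn0) hp
      have hlam0 : 0 < lam0 := by
        have : 0 < Real.log p := Real.log_pos (by exact_mod_cast hp2)
        rw [hlam]; positivity
      refine ⟨_, .iUnion fun j =>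
        (isClosed_largeEntrySet X β hlam0 τ (2 * s) j).measurableSet.inter
          (measurableSet_le measurable_const
            ((continuous_transpose_mulVec_apply X j).measurable.const_mul τ')),
        (measureReal_largeEntry_le hX hn0 hv β (U := U) hlam0 hτ hτ' hs (hae hp τ)).trans ?_,
        fun ε hε _ j hj => ?_⟩
      · have h5 : Real.exp (-(s * U - s ^ 2 * n / 2) / v) ≤ 1 / (n : ℝ) ^ 3 := by
          rw [← exp_neg_nat_mul_log hn0]
          refine Real.exp_le_exp.2 ?_
          rw [hvR, div_le_iff₀ (by positivity)]
          push_cast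
          linarith
        calc _ ≤ 1 / (n : ℝ) ^ 3 * n := by gcongr
          _ = 1 / (n : ℝ) ^ 2 := by field_simp
      · by_contra! hlt
        exact hε (Set.mem_iUnion.2 ⟨j, hj, hlt⟩)
    · exact ⟨∅, .empty, by simp, fun ε _ h => absurd h hp⟩
  obtain ⟨B₄, mB₄, bB₄, hB₄⟩ := h4 1 1 (.inl rfl) (.inl rfl)
  obtain ⟨B₅, mB₅, bB₅, hB₅⟩ := h4 1 (-1) (.inl rfl) (.inr rfl)
  obtain ⟨B₆, mB₆, bB₆, hB₆⟩ := h4 (-1) 1 (.inr rfl) (.inl rfl)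
  obtain ⟨B₇, mB₇, bB₇, hB₇⟩ := h4 (-1) (-1) (.inr rfl) (.inr rfl)
  have mB := (((((mB₁.union mB₂).union mB₃).union mB₄).union mB₅).union mB₆).union mB₇
  refine ⟨(B₁ ∪ B₂ ∪ B₃ ∪ B₄ ∪ B₅ ∪ B₆ ∪ B₇)ᶜ, mB.compl, ?_, fun ε hε => ?_⟩
  · rw [probReal_compl_eq_one_sub mB]
    have hu : γ.real (B₁ ∪ B₂ ∪ B₃ ∪ B₄ ∪ B₅ ∪ B₆ ∪ B₇)
        ≤ 4 / (n : ℝ) ^ 3 + 6 * (1 / (n : ℝ) ^ 2) := by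
      linarith [measureReal_union_le (μ := γ) (B₁ ∪ B₂ ∪ B₃ ∪ B₄ ∪ B₅ ∪ B₆) B₇,
        measureReal_union_le (μ := γ) (B₁ ∪ B₂ ∪ B₃ ∪ B₄ ∪ B₅) B₆,
        measureReal_union_le (μ := γ) (B₁ ∪ B₂ ∪ B₃ ∪ B₄) B₅,
        measureReal_union_le (μ := γ) (B₁ ∪ B₂ ∪ B₃) B₄,
        measureReal_union_le (μ := γ) (B₁ ∪ B₂) B₃, measureReal_union_le (μ := γ) B₁ B₂]
    have hfin : 4 / (n : ℝ) ^ 3 + 6 * (1 / (n : ℝ) ^ 2) ≤ 1 / n := by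
      rw [div_add' _ _ _ (by positivity), div_le_div_iff₀ (by positivity) (by positivity)]
      field_simp
      nlinarith
    linarith
  · simp only [Set.mem_compl_iff, Set.mem_union, not_or] at hε
    obtain ⟨⟨⟨⟨⟨⟨h1, h2⟩, h3⟩, h4⟩, h5⟩, h6⟩, h7⟩ := hε
    refine ⟨hB₁ ε h1, hB₂ ε h2, hB₃ ε h3, fun hp τ τ' hτ hτ' => ?_⟩
    rcases hτ with rfl | rfl <;> rcases hτ' with rfl | rfl
    · exact hB₄ ε h4 hp
    · exact hB₅ ε h5 hp
    · exact hB₆ ε h6 hp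
    · exact hB₇ ε h7 hp

end Noise

/-! ### Estimation error of the Lasso -/

section LassoError

variable {n p : ℕ} {X : Matrix (Fin n) (Fin p) ℝ}

lemma variational_of_isArgMin {y : Fin n → ℝ} {w b : Fin p → ℝ} {K : Set (Fin p → ℝ)}
    (hK : Convex ℝ K) (hw : ∀ j, 0 ≤ w j) (h : IsArgMin (penObj X y w) K b)
    {z : Fin p → ℝ} (hz : z ∈ K) :
    (y - X *ᵥ b) ⬝ᵥ (X *ᵥ (z - b)) ≤ ∑ j, w j * |z j| - ∑ j, w j * |b j| := by
  refine variational_inequality X hK hw h.1 (fun v hv => ?_) hz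
  rcases eq_or_ne v b with rfl | hne
  · exact le_rfl
  · exact (h.2 v hv hne).le

/-- A Lasso error either lies in the cone of the restricted eigenvalue condition, with the usual
rate, or is entrywise negligible. The noise is only required to be close to a vector `ε'` that is
weakly correlated with the columns; the distance `E` is absorbed by the quadratic term. -/
lemma lasso_error_dichotomy {β b : Fin p → ℝ} {ε ε' : Fin n → ℝ} {lam0 K₂ E : ℝ}
    (hlam : 0 ≤ lam0) (hn : 0 < n) (hRE : RestrictedEigenvalue (gram X) (supp β) K₂)
    (hb : IsArgMin (lassoObj X (X *ᵥ β + ε) lam0) Set.univ b)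
    (hε' : ∀ j, |(Xᵀ *ᵥ ε') j| ≤ 7 / 16 * lam0) (hE : l2Norm (ε - ε') ^ 2 ≤ E) :
    (∑ j ∈ (supp β)ᶜ, |(b - β) j| ≤ 3 * ∑ j ∈ supp β, |(b - β) j| ∧
      n * K₂ * l2Norm (b - β) ^ 2
        ≤ E + 3 * lam0 * (√((supp β).card : ℝ) * l2Norm (b - β))) ∨
    ∀ j, lam0 * |(b - β) j| ≤ 6 * E := by
  have hb' : IsArgMin (penObj X (X *ᵥ β + ε) fun _ => lam0) Set.univ b :=
    ⟨trivial, fun v hv hne => by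
      rw [← lassoObj_eq_penObj, ← lassoObj_eq_penObj]; exact hb.2 v hv hne⟩
  have hbasic := basic_inequality X (variational_of_isArgMin convex_univ (fun _ => hlam) hb'
    (Set.mem_univ β))
  set v := b - β with hv
  set S := supp β
  have hsplit : ∀ f : Fin p → ℝ, ∑ j, f j = ∑ j ∈ S, f j + ∑ j ∈ Sᶜ, f j := fun f =>
    (Finset.sum_add_sum_compl S f).symm
  have hpen : ∑ j, lam0 * |β j| - ∑ j, lam0 * |b j|
      ≤ lam0 * (∑ j ∈ S, |v j| - ∑ j ∈ Sᶜ, |v j|) := by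
    rw [← Finset.mul_sum, ← Finset.mul_sum, ← mul_sub]
    refine mul_le_mul_of_nonneg_left ?_ hlam
    rw [hsplit fun j => |β j|, hsplit fun j => |b j|]
    have h1 : ∑ j ∈ S, |β j| - ∑ j ∈ S, |b j| ≤ ∑ j ∈ S, |v j| := by
      rw [← Finset.sum_sub_distrib]
      refine Finset.sum_le_sum fun j _ => ?_
      rw [hv, Pi.sub_apply, abs_sub_comm]
      exact abs_sub_abs_le_abs_sub _ _
    have h2 : ∀ j ∈ Sᶜ, β j = 0 := fun j hj => by
      simpa [S, mem_supp] using hj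
    have h3 : ∑ j ∈ Sᶜ, |β j| = 0 := Finset.sum_eq_zero fun j hj => by rw [h2 j hj, abs_zero]
    have h4 : ∑ j ∈ Sᶜ, |b j| = ∑ j ∈ Sᶜ, |v j| :=
      Finset.sum_congr rfl fun j hj => by rw [hv, Pi.sub_apply, h2 j hj, sub_zero]
    linarith
  have hnoise : ε ⬝ᵥ (X *ᵥ v) ≤ 7 / 16 * lam0 * (∑ j ∈ S, |v j| + ∑ j ∈ Sᶜ, |v j|)
      + (1 / 2 * E + 1 / 2 * l2Norm (X *ᵥ v) ^ 2) := by
    have e : ε ⬝ᵥ (X *ᵥ v) = (Xᵀ *ᵥ ε') ⬝ᵥ v + (ε - ε') ⬝ᵥ (X *ᵥ v) := by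
      rw [← dotProduct_mulVec_eq, ← add_dotProduct]; congr 1; abel
    rw [e, ← hsplit fun j => |v j|]
    have h1 := (le_abs_self _).trans (abs_dotProduct_le_sum (Xᵀ *ᵥ ε') v hε')
    have h2 := (le_abs_self _).trans (abs_dotProduct_le (ε - ε') (X *ᵥ v))
    nlinarith [sq_nonneg (l2Norm (ε - ε') - l2Norm (X *ᵥ v))]
  have hmain : 1 / 2 * l2Norm (X *ᵥ v) ^ 2 + 9 / 16 * lam0 * ∑ j ∈ Sᶜ, |v j|
      ≤ 1 / 2 * E + 23 / 16 * lam0 * ∑ j ∈ S, |v j| := by linarith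
  have hSc0 : 0 ≤ ∑ j ∈ Sᶜ, |v j| := Finset.sum_nonneg fun j _ => abs_nonneg _
  have hS0 : 0 ≤ ∑ j ∈ S, |v j| := Finset.sum_nonneg fun j _ => abs_nonneg _
  rcases le_or_gt (∑ j ∈ Sᶜ, |v j|) (3 * ∑ j ∈ S, |v j|) with hcone | hcone
  · refine .inl ⟨hcone, ?_⟩
    have h1 := hRE.le_l2Norm_mulVec hn hcone
    have h2 := mul_le_mul_of_nonneg_left (sum_abs_le_sqrt_card_mul_l2Norm S v) hlam
    nlinarith [mul_nonneg hlam hSc0, mul_nonneg hlam hS0]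
  · refine .inr fun j => ?_
    have h1 : |v j| ≤ ∑ j ∈ Sᶜ, |v j| := by
      by_cases hj : j ∈ S
      · have := Finset.single_le_sum (f := fun j => |v j|) (fun j _ => abs_nonneg _) hj
        linarith
      · exact Finset.single_le_sum (f := fun j => |v j|) (fun j _ => abs_nonneg _)
          (Finset.mem_compl.2 hj)
    have h2 := mul_le_mul_of_nonneg_left h1 hlam
    have h3 := mul_le_mul_of_nonneg_left hcone.le hlam
    nlinarith [sq_nonneg (l2Norm (X *ᵥ v))]

/-- With a single column the Lasso penalty level `4 σ √(n log p)` vanishes and the Lasso is least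
squares. -/
lemma least_squares_error (hX : Standardized X) (hn : 0 < n) (hp : p ≤ 1) {β b : Fin p → ℝ}
    {ε : Fin n → ℝ} (hb : IsArgMin (lassoObj X (X *ᵥ β + ε) 0) Set.univ b) (j : Fin p) :
    n * (b - β) j = (Xᵀ *ᵥ ε) j := by
  have : Subsingleton (Fin p) := Fin.subsingleton_iff_le_one.2 hp
  have hb' : IsArgMin (penObj X (X *ᵥ β + ε) fun _ => 0) Set.univ b :=
    ⟨trivial, fun v hv hne => by
      rw [← lassoObj_eq_penObj, ← lassoObj_eq_penObj]; exact hb.2 v hv hne⟩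
  have hVI := fun z => variational_of_isArgMin convex_univ (fun _ => le_rfl) hb' (Set.mem_univ z)
  have e : X *ᵥ β + ε - X *ᵥ b = ε - X *ᵥ (b - β) := by rw [Matrix.mulVec_sub]; abel
  have hcol : ∀ v : Fin p → ℝ, X *ᵥ v = v j • fun i => X i j := fun v => by
    ext i
    rw [Matrix.mulVec, dotProduct, Finset.sum_eq_single j
      (fun k _ hk => absurd (Subsingleton.elim k j) hk) (by simp)]
    simp [mul_comm]
  have h1 := hVI (b + Pi.single j 1)
  have h2 := hVI (b - Pi.single j 1)
  rw [e, add_sub_cancel_left, hcol (Pi.single j 1)] at h1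
  rw [e, sub_sub_cancel_left, Matrix.mulVec_neg, hcol (Pi.single j 1), dotProduct_neg] at h2
  simp only [Pi.single_eq_same, one_smul, zero_mul, Finset.sum_const_zero, sub_zero] at h1 h2
  have h3 : (ε - X *ᵥ (b - β)) ⬝ᵥ (fun i => X i j) = 0 := by linarith
  rw [sub_dotProduct, hcol (b - β), smul_dotProduct, col_dotProduct_self hX hn,
    dotProduct_comm] at h3
  rw [transpose_mulVec_apply]
  rw [smul_eq_mul] at h3
  linarith

end LassoError

/-! ### The screening steps -/

section Steps

variable {n p : ℕ} {X : Matrix (Fin n) (Fin p) ℝ}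

lemma convex_vanishing (A : Finset (Fin p)) : Convex ℝ {v : Fin p → ℝ | ∀ j ∉ A, v j = 0} := by
  intro x hx y hy a b _ _ _ j hj
  simp [hx j hj, hy j hj]

/-- What is needed of an iterate for the next screening step to be accurate: entries in `S` are
bounded away from zero at the level `m`, and entries off `S` are at most `m` and so small that
their weights in the next step dominate the noise. -/
structure IsScreened (X : Matrix (Fin n) (Fin p) ℝ) (S : Finset (Fin p)) (ε : Fin n → ℝ)
    (lam m : ℝ) (b : Fin p → ℝ) : Prop where
  le_abs : ∀ j ∈ S, m ≤ |b j|
  abs_le : ∀ j ∉ S, |b j| ≤ m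
  noise : ∀ j ∉ S, |(Xᵀ *ᵥ ε) j| * |b j| ≤ lam / 4

lemma supp_subset_of_isArgMin_step {y : Fin n → ℝ} {lam : ℝ} {prev b : Fin p → ℝ}
    (hb : IsArgMin (stepObj X y lam prev) {v | ∀ j ∉ supp prev, v j = 0} b) :
    supp b ⊆ supp prev := fun j hj => by
  by_contra h
  exact mem_supp.1 hj (hb.1 j h)

lemma variational_step {y : Fin n → ℝ} {lam : ℝ} (hlam : 0 ≤ lam) {prev b : Fin p → ℝ}
    (hb : IsArgMin (stepObj X y lam prev) {v | ∀ j ∉ supp prev, v j = 0} b)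
    {z : Fin p → ℝ} (hz : supp z ⊆ supp prev) :
    (y - X *ᵥ b) ⬝ᵥ (X *ᵥ (z - b))
      ≤ ∑ j, lam / |prev j| * |z j| - ∑ j, lam / |prev j| * |b j| := by
  have hb' : IsArgMin (penObj X y fun j => lam / |prev j|) {v | ∀ j ∉ supp prev, v j = 0} b :=
    ⟨hb.1, fun v hv hne => by
      rw [← stepObj_eq_penObj, ← stepObj_eq_penObj]; exact hb.2 v hv hne⟩
  refine variational_of_isArgMin (convex_vanishing _) (fun j => div_nonneg hlam (abs_nonneg _))
    hb' fun j hj => ?_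
  by_contra h
  exact hj (hz (mem_supp.2 h))

/-- The variational inequality of a screening step, tested at the true coefficient vector. -/
lemma step_inequality {β prev b : Fin p → ℝ} {ε : Fin n → ℝ} {lam m : ℝ} (hlam : 0 < lam)
    (hm : 0 < m) (hm1 : m ≤ 1) (hprev : IsScreened X (supp β) ε lam m prev)
    (hS : ∀ j ∈ supp β, |(Xᵀ *ᵥ ε) j| ≤ lam)
    (hb : IsArgMin (stepObj X (X *ᵥ β + ε) lam prev) {v | ∀ j ∉ supp prev, v j = 0} b) :
    l2Norm (X *ᵥ (b - β)) ^ 2 + ∑ j ∈ (supp β)ᶜ, 3 / 4 * (lam / |prev j|) * |(b - β) j|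
      ≤ 2 * lam / m * ∑ j ∈ supp β, |(b - β) j| := by
  have hsub : supp β ⊆ supp prev := fun j hj => mem_supp.2 fun h0 => by
    have := hprev.le_abs j hj
    rw [h0, abs_zero] at this
    linarith
  have hbasic := basic_inequality X (variational_step hlam.le hb hsub)
  set v := b - β with hv
  rw [dotProduct_mulVec_eq, dotProduct, ← Finset.sum_sub_distrib, ← Finset.sum_add_distrib,
    ← Finset.sum_add_sum_compl (supp β)] at hbasic
  have h1 : ∑ j ∈ supp β, ((Xᵀ *ᵥ ε) j * v j + (lam / |prev j| * |β j| - lam / |prev j| * |b j|))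
      ≤ 2 * lam / m * ∑ j ∈ supp β, |v j| := by
    rw [Finset.mul_sum]
    refine Finset.sum_le_sum fun j hj => ?_
    have e1 : (Xᵀ *ᵥ ε) j * v j ≤ lam / m * |v j| := by
      refine (le_abs_self _).trans ?_
      rw [abs_mul]
      refine mul_le_mul_of_nonneg_right ((hS j hj).trans ?_) (abs_nonneg _)
      rw [le_div_iff₀ hm]
      nlinarith
    have e2 : lam / |prev j| * (|β j| - |b j|) ≤ lam / m * |v j| := by
      have e3 : |β j| - |b j| ≤ |v j| := by
        rw [hv, Pi.sub_apply, abs_sub_comm]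
        exact abs_sub_abs_le_abs_sub _ _
      have e4 : lam / |prev j| ≤ lam / m :=
        div_le_div_of_nonneg_left hlam.le hm (hprev.le_abs j hj)
      have e5 : 0 ≤ lam / |prev j| := div_nonneg hlam.le (abs_nonneg _)
      calc lam / |prev j| * (|β j| - |b j|) ≤ lam / |prev j| * |v j| := by gcongr
        _ ≤ lam / m * |v j| := by gcongr
    have e6 : 2 * lam / m = lam / m + lam / m := by ring
    rw [e6]
    linarith
  have h2 : ∑ j ∈ (supp β)ᶜ,
      ((Xᵀ *ᵥ ε) j * v j + (lam / |prev j| * |β j| - lam / |prev j| * |b j|))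
      ≤ -∑ j ∈ (supp β)ᶜ, 3 / 4 * (lam / |prev j|) * |v j| := by
    rw [← Finset.sum_neg_distrib]
    refine Finset.sum_le_sum fun j hj => ?_
    have hj' : j ∉ supp β := Finset.mem_compl.1 hj
    have hβ : β j = 0 := by simpa [mem_supp] using hj'
    have hvb : v j = b j := by rw [hv, Pi.sub_apply, hβ, sub_zero]
    rw [hvb, hβ, abs_zero, mul_zero]
    rcases eq_or_ne (prev j) 0 with h0 | h0
    · have : b j = 0 := hb.1 j (by simp [mem_supp, h0])
      simp [this]
    · have e1 : |(Xᵀ *ᵥ ε) j| ≤ 1 / 4 * (lam / |prev j|) := by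
        rw [← mul_div_assoc, le_div_iff₀ (abs_pos.2 h0)]
        linarith [hprev.noise j hj']
      have e2 : (Xᵀ *ᵥ ε) j * b j ≤ 1 / 4 * (lam / |prev j|) * |b j| := by
        refine (le_abs_self _).trans ?_
        rw [abs_mul]
        exact mul_le_mul_of_nonneg_right e1 (abs_nonneg _)
      linarith
  linarith

/-- The error of a screening step lies in the cone of the restricted eigenvalue condition. -/
lemma step_cone {β prev b : Fin p → ℝ} {ε : Fin n → ℝ} {lam m : ℝ} (hlam : 0 < lam)
    (hm : 0 < m) (hm1 : m ≤ 1) (hprev : IsScreened X (supp β) ε lam m prev)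
    (hS : ∀ j ∈ supp β, |(Xᵀ *ᵥ ε) j| ≤ lam)
    (hb : IsArgMin (stepObj X (X *ᵥ β + ε) lam prev) {v | ∀ j ∉ supp prev, v j = 0} b) :
    ∑ j ∈ (supp β)ᶜ, |(b - β) j| ≤ 3 * ∑ j ∈ supp β, |(b - β) j| := by
  have h := step_inequality hlam hm hm1 hprev hS hb
  have h1 : 3 / 4 * (lam / m) * ∑ j ∈ (supp β)ᶜ, |(b - β) j|
      ≤ ∑ j ∈ (supp β)ᶜ, 3 / 4 * (lam / |prev j|) * |(b - β) j| := by
    rw [Finset.mul_sum]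
    refine Finset.sum_le_sum fun j hj => ?_
    have hj' : j ∉ supp β := Finset.mem_compl.1 hj
    have hβ : β j = 0 := by simpa [mem_supp] using hj'
    rcases eq_or_ne (prev j) 0 with h0 | h0
    · have : b j = 0 := hb.1 j (by simp [mem_supp, h0])
      simp [this, hβ]
    · have : lam / m ≤ lam / |prev j| :=
        div_le_div_of_nonneg_left hlam.le (abs_pos.2 h0) (hprev.abs_le j hj')
      gcongr
  have h2 : 2 * lam / m = 2 * (lam / m) := by ring
  rw [h2] at h
  have h3 : lam / m * (3 / 4 * ∑ j ∈ (supp β)ᶜ, |(b - β) j|)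
      ≤ lam / m * (2 * ∑ j ∈ supp β, |(b - β) j|) := by
    nlinarith [sq_nonneg (l2Norm (X *ᵥ (b - β)))]
  have h4 := le_of_mul_le_mul_left h3 (div_pos hlam hm)
  have h5 : 0 ≤ ∑ j ∈ supp β, |(b - β) j| := Finset.sum_nonneg fun j _ => abs_nonneg _
  linarith

/-- The error bound of a screening step: as the error lies in the cone, the restricted eigenvalue
condition turns the variational inequality into an `ℓ₂` rate. -/
lemma step_l2Norm_le {β prev b : Fin p → ℝ} {ε : Fin n → ℝ} {lam m K₂ R : ℝ} (hlam : 0 < lam)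
    (hm : 0 < m) (hm1 : m ≤ 1) (hprev : IsScreened X (supp β) ε lam m prev)
    (hS : ∀ j ∈ supp β, |(Xᵀ *ᵥ ε) j| ≤ lam) (hn : 0 < n) (hK₂ : 0 < K₂)
    (hRE : RestrictedEigenvalue (gram X) (supp β) K₂)
    (hR : n * K₂ * R = 2 * lam / m * √((supp β).card : ℝ))
    (hb : IsArgMin (stepObj X (X *ᵥ β + ε) lam prev) {v | ∀ j ∉ supp prev, v j = 0} b) :
    l2Norm (b - β) ≤ R := by
  have hn' : (0 : ℝ) < n := by positivity
  have h1 := step_inequality hlam hm hm1 hprev hS hb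
  have h2 := hRE.le_l2Norm_mulVec hn (step_cone hlam hm hm1 hprev hS hb)
  have h3 := sum_abs_le_sqrt_card_mul_l2Norm (supp β) (b - β)
  have h4 : 0 ≤ ∑ j ∈ (supp β)ᶜ, 3 / 4 * (lam / |prev j|) * |(b - β) j| :=
    Finset.sum_nonneg fun j _ => by positivity
  have h5 : n * K₂ * l2Norm (b - β) ^ 2 ≤ n * K₂ * R * l2Norm (b - β) := by
    rw [hR]
    have : 2 * lam / m * ∑ j ∈ supp β, |(b - β) j|
        ≤ 2 * lam / m * (√((supp β).card : ℝ) * l2Norm (b - β)) := by gcongr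
    linarith
  rcases (l2Norm_nonneg (b - β)).eq_or_lt with h0 | h0
  · rw [← h0]
    have : 0 ≤ n * K₂ * R := by rw [hR]; positivity
    exact nonneg_of_mul_nonneg_right this (by positivity)
  · have h6 : n * K₂ * l2Norm (b - β) * l2Norm (b - β) ≤ n * K₂ * R * l2Norm (b - β) := by
      nlinarith
    have h7 := le_of_mul_le_mul_right h6 h0
    exact le_of_mul_le_mul_left h7 (by positivity)

/-- A screening step halves every entry off the true support: the weighted `ℓ₁` term of
`step_inequality` bounds the ratio of consecutive entries. -/
lemma step_shrink {β prev b : Fin p → ℝ} {ε : Fin n → ℝ} {lam m R : ℝ} (hlam : 0 < lam)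
    (hm : 0 < m) (hm1 : m ≤ 1) (hprev : IsScreened X (supp β) ε lam m prev)
    (hS : ∀ j ∈ supp β, |(Xᵀ *ᵥ ε) j| ≤ lam)
    (hb : IsArgMin (stepObj X (X *ᵥ β + ε) lam prev) {v | ∀ j ∉ supp prev, v j = 0} b)
    (hbR : l2Norm (b - β) ≤ R) (hRm : 16 * (√((supp β).card : ℝ) * R) ≤ 3 * m)
    {j : Fin p} (hj : j ∉ supp β) : |b j| ≤ 1 / 2 * |prev j| := by
  rcases eq_or_ne (prev j) 0 with h0 | h0
  · have : b j = 0 := hb.1 j (by simp [mem_supp, h0])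
    simp [this]
  have h1 := step_inequality hlam hm hm1 hprev hS hb
  have hβ : β j = 0 := by simpa [mem_supp] using hj
  have h2 : 3 / 4 * (lam / |prev j|) * |b j|
      ≤ ∑ j ∈ (supp β)ᶜ, 3 / 4 * (lam / |prev j|) * |(b - β) j| := by
    have := Finset.single_le_sum (f := fun j => 3 / 4 * (lam / |prev j|) * |(b - β) j|)
      (fun j _ => by positivity) (Finset.mem_compl.2 hj)
    simpa [hβ] using this
  have h3 := sum_abs_le_sqrt_card_mul_l2Norm (supp β) (b - β)
  have h4 : 2 * lam / m * ∑ j ∈ supp β, |(b - β) j| ≤ 3 / 8 * lam := by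
    have : ∑ j ∈ supp β, |(b - β) j| ≤ 3 / 16 * m := by
      have := mul_le_mul_of_nonneg_left hbR (Real.sqrt_nonneg ((supp β).card : ℝ))
      linarith
    calc 2 * lam / m * ∑ j ∈ supp β, |(b - β) j| ≤ 2 * lam / m * (3 / 16 * m) := by gcongr
      _ = 3 / 8 * lam := by field_simp; ring
  have hp := abs_pos.2 h0
  have h5 : 3 / 4 * (lam / |prev j|) * |b j| ≤ 3 / 8 * lam := by
    nlinarith [sq_nonneg (l2Norm (X *ᵥ (b - β)))]
  have h6 : 3 / 4 * (lam / |prev j|) * |b j| = 3 / 4 * lam * |b j| / |prev j| := by ring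
  rw [h6, div_le_iff₀ hp] at h5
  have h7 : lam * |b j| ≤ lam * (1 / 2 * |prev j|) := by linarith
  exact le_of_mul_le_mul_left h7 hlam

/-- At an active entry, the weight does not exceed the correlation of the column with the
residual. -/
lemma step_weight_le {y : Fin n → ℝ} {lam : ℝ} (hlam : 0 ≤ lam) {prev b : Fin p → ℝ}
    (hb : IsArgMin (stepObj X y lam prev) {v | ∀ j ∉ supp prev, v j = 0} b) {j : Fin p}
    (hj : b j ≠ 0) : lam / |prev j| ≤ |(Xᵀ *ᵥ (y - X *ᵥ b)) j| := by
  have hsub : supp (b - Pi.single j (b j)) ⊆ supp prev := fun i hi => by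
    refine supp_subset_of_isArgMin_step hb (mem_supp.2 fun h0 => mem_supp.1 hi ?_)
    rcases eq_or_ne i j with rfl | hne
    · simp
    · simp [h0, hne]
  have h := variational_step hlam hb hsub
  rw [sub_sub_cancel_left, dotProduct_mulVec_eq, dotProduct_neg, dotProduct_single,
    ← Finset.sum_sub_distrib, Finset.sum_eq_single j] at h
  · simp only [Pi.sub_apply, Pi.single_eq_same, sub_self, abs_zero, mul_zero, zero_sub] at h
    have h1 : lam / |prev j| * |b j| ≤ |(Xᵀ *ᵥ (y - X *ᵥ b)) j| * |b j| := by
      rw [← abs_mul]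
      exact (neg_le_neg_iff.1 h).trans (le_abs_self _)
    exact le_of_mul_le_mul_right h1 (abs_pos.2 hj)
  · intro i _ hi
    simp [hi]
  · simp

/-- Two consecutive screening steps on the same active set: the map from an iterate to the next
is a contraction, because the weights depend on the iterate in a Lipschitz way. -/
lemma step_contraction {y : Fin n → ℝ} {S : Finset (Fin p)} {lam m K₂ : ℝ} (hlam : 0 < lam)
    (hm : 0 < m) (hn : 0 < n) (hK₂ : 0 < K₂) (hRE : RestrictedEigenvalue (gram X) S K₂)
    (hcontr : 2 * lam ≤ n * K₂ * m ^ 2) {b₀ b₁ b₂ : Fin p → ℝ}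
    (h₀ : supp b₀ = S) (h₁ : supp b₁ = S) (h₂ : supp b₂ = S)
    (hm₀ : ∀ j ∈ S, m ≤ |b₀ j|) (hm₁ : ∀ j ∈ S, m ≤ |b₁ j|)
    (hb₁ : IsArgMin (stepObj X y lam b₀) {v | ∀ j ∉ supp b₀, v j = 0} b₁)
    (hb₂ : IsArgMin (stepObj X y lam b₁) {v | ∀ j ∉ supp b₁, v j = 0} b₂) :
    l2Norm (b₂ - b₁) ≤ 1 / 2 * l2Norm (b₁ - b₀) := by
  have hn' : (0 : ℝ) < n := by positivity
  have e1 := variational_step hlam.le hb₁ (z := b₂) (by rw [h₂, h₀])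
  have e2 := variational_step hlam.le hb₂ (z := b₁) le_rfl
  have e3 : l2Norm (X *ᵥ (b₂ - b₁)) ^ 2
      = (y - X *ᵥ b₁) ⬝ᵥ (X *ᵥ (b₂ - b₁)) + (y - X *ᵥ b₂) ⬝ᵥ (X *ᵥ (b₁ - b₂)) := by
    have : X *ᵥ (b₁ - b₂) = -(X *ᵥ (b₂ - b₁)) := by rw [← Matrix.mulVec_neg, neg_sub]
    rw [this, dotProduct_neg, ← sub_eq_add_neg, ← sub_dotProduct, l2Norm_sq_eq_dotProduct]
    congr 1
    rw [Matrix.mulVec_sub]; abel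
  have hoff : ∀ (b : Fin p → ℝ), supp b = S → ∀ j ∉ S, b j = 0 := fun b hb j hj => by
    rw [← hb] at hj
    simpa [mem_supp] using hj
  have e4 : l2Norm (X *ᵥ (b₂ - b₁)) ^ 2
      ≤ (lam / m ^ 2) * (l2Norm (b₁ - b₀) * l2Norm (b₂ - b₁)) := by
    have h5 : ∑ j, (lam / |b₀ j| * |b₂ j| - lam / |b₀ j| * |b₁ j|
        + (lam / |b₁ j| * |b₁ j| - lam / |b₁ j| * |b₂ j|))
        ≤ ∑ j, lam / m ^ 2 * (|(b₁ - b₀) j| * |(b₂ - b₁) j|) := by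
      refine Finset.sum_le_sum fun j _ => ?_
      by_cases hj : j ∈ S
      swap
      · simp [hoff b₀ h₀ j hj, hoff b₁ h₁ j hj, hoff b₂ h₂ j hj]
      have p0 : 0 < |b₀ j| := hm.trans_le (hm₀ j hj)
      have p1 : 0 < |b₁ j| := hm.trans_le (hm₁ j hj)
      have e5 : lam / |b₀ j| * |b₂ j| - lam / |b₀ j| * |b₁ j|
          + (lam / |b₁ j| * |b₁ j| - lam / |b₁ j| * |b₂ j|)
          = lam / (|b₀ j| * |b₁ j|) * ((|b₁ j| - |b₀ j|) * (|b₂ j| - |b₁ j|)) := by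
        field_simp
        ring
      rw [e5]
      have e6 : (|b₁ j| - |b₀ j|) * (|b₂ j| - |b₁ j|) ≤ |(b₁ - b₀) j| * |(b₂ - b₁) j| := by
        refine (le_abs_self _).trans ?_
        rw [abs_mul]
        exact mul_le_mul (abs_abs_sub_abs_le_abs_sub _ _) (abs_abs_sub_abs_le_abs_sub _ _)
          (abs_nonneg _) (abs_nonneg _)
      have e7 : lam / (|b₀ j| * |b₁ j|) ≤ lam / m ^ 2 := by
        refine div_le_div_of_nonneg_left hlam.le (by positivity) ?_
        rw [sq]
        exact mul_le_mul (hm₀ j hj) (hm₁ j hj) hm.le (abs_nonneg _)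
      calc _ ≤ lam / (|b₀ j| * |b₁ j|) * (|(b₁ - b₀) j| * |(b₂ - b₁) j|) := by gcongr
        _ ≤ _ := by gcongr
    have h6 : ∑ j, |(b₁ - b₀) j| * |(b₂ - b₁) j| ≤ l2Norm (b₁ - b₀) * l2Norm (b₂ - b₁) := by
      have := (le_abs_self _).trans (abs_dotProduct_le (fun j => |(b₁ - b₀) j|)
        (fun j => |(b₂ - b₁) j|))
      have habs : ∀ w : Fin p → ℝ, l2Norm (fun j => |w j|) = l2Norm w := fun w => by
        rw [← Real.sqrt_sq (l2Norm_nonneg w), ← Real.sqrt_sq (l2Norm_nonneg fun j => |w j|),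
          l2Norm_sq, l2Norm_sq]
        simp
      rwa [habs, habs] at this
    rw [← Finset.mul_sum] at h5
    simp only [Finset.sum_add_distrib, Finset.sum_sub_distrib] at h5
    have h7 : lam / m ^ 2 * ∑ j, |(b₁ - b₀) j| * |(b₂ - b₁) j|
        ≤ lam / m ^ 2 * (l2Norm (b₁ - b₀) * l2Norm (b₂ - b₁)) := by gcongr
    linarith
  have hcone : ∑ j ∈ Sᶜ, |(b₂ - b₁) j| ≤ 3 * ∑ j ∈ S, |(b₂ - b₁) j| := by
    have : ∑ j ∈ Sᶜ, |(b₂ - b₁) j| = 0 := Finset.sum_eq_zero fun j hj => by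
      have hj' := Finset.mem_compl.1 hj
      simp [hoff b₁ h₁ j hj', hoff b₂ h₂ j hj']
    rw [this]
    exact mul_nonneg (by norm_num) (Finset.sum_nonneg fun j _ => abs_nonneg _)
  have e8 := hRE.le_l2Norm_mulVec hn hcone
  have e9 : lam / m ^ 2 ≤ n * K₂ * (1 / 2) := by
    rw [div_le_iff₀ (by positivity)]; linarith
  have e10 : n * K₂ * l2Norm (b₂ - b₁) ^ 2
      ≤ n * K₂ * (1 / 2) * (l2Norm (b₁ - b₀) * l2Norm (b₂ - b₁)) := by
    refine e8.trans (e4.trans (mul_le_mul_of_nonneg_right e9 ?_))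
    exact mul_nonneg (l2Norm_nonneg _) (l2Norm_nonneg _)
  rcases (l2Norm_nonneg (b₂ - b₁)).eq_or_lt with h0 | h0
  · rw [← h0]
    linarith [l2Norm_nonneg (b₁ - b₀)]
  · have h1 : n * K₂ * l2Norm (b₂ - b₁) * (l2Norm (b₂ - b₁))
        ≤ n * K₂ * l2Norm (b₂ - b₁) * (1 / 2 * l2Norm (b₁ - b₀)) := by nlinarith
    exact le_of_mul_le_mul_left h1 (by positivity)

end Steps

/-! ### Convergence of the iterates -/

section Path

variable {n p : ℕ} {X : Matrix (Fin n) (Fin p) ℝ}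

lemma exists_tendsto_of_contraction {b : ℕ → Fin p → ℝ} {k₀ : ℕ}
    (h : ∀ k, k₀ ≤ k → l2Norm (b (k + 2) - b (k + 1)) ≤ 1 / 2 * l2Norm (b (k + 1) - b k)) :
    ∃ bhat, Tendsto b atTop (𝓝 bhat) := by
  have hgeo : ∀ k, l2Norm (b (k₀ + k + 1) - b (k₀ + k))
      ≤ l2Norm (b (k₀ + 1) - b k₀) * (1 / 2) ^ k := by
    intro k
    induction k with
    | zero => simp
    | succ k ih =>
      have := h (k₀ + k) (by omega)
      rw [pow_succ]
      calc _ ≤ 1 / 2 * l2Norm (b (k₀ + k + 1) - b (k₀ + k)) := this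
        _ ≤ _ := by linarith
  have hc : CauchySeq fun k => b (k₀ + k) := by
    refine cauchySeq_of_le_geometric (1 / 2) (l2Norm (b (k₀ + 1) - b k₀)) (by norm_num)
      fun k => ?_
    rw [dist_comm, dist_eq_norm]
    exact (norm_le_l2Norm _).trans (hgeo k)
  obtain ⟨bhat, hb⟩ := cauchySeq_tendsto_of_complete hc
  refine ⟨bhat, (tendsto_add_atTop_iff_nat k₀).1 ?_⟩
  simpa only [add_comm] using hb

/-- Convergence of the screening iterates from a screened initial vector, for fixed noise. The
entries off the true support decay geometrically; once they are small enough their weights exceed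
the correlations with the residuals and they vanish, after which the iteration is a
contraction. -/
lemma path_converges (hX : Standardized X) (hn : 0 < n) {β : Fin p → ℝ} {ε : Fin n → ℝ}
    {lam m K₂ R : ℝ} (hlam : 0 < lam) (hm : 0 < m) (hm1 : m ≤ 1) (hK₂ : 0 < K₂)
    (hRE : RestrictedEigenvalue (gram X) (supp β) K₂)
    (hS : ∀ j ∈ supp β, |(Xᵀ *ᵥ ε) j| ≤ lam)
    (hR : n * K₂ * R = 2 * lam / m * √((supp β).card : ℝ))
    (hmin : ∀ j ∈ supp β, m + R ≤ |β j|) (hRm : R ≤ m)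
    (hu : ∀ j, |(Xᵀ *ᵥ ε) j| * R ≤ lam / 4)
    (hRm2 : 16 * (√((supp β).card : ℝ) * R) ≤ 3 * m)
    (hcontr : 2 * lam ≤ n * K₂ * m ^ 2) {b : ℕ → Fin p → ℝ}
    (h0 : IsScreened X (supp β) ε lam m (b 0))
    (hpath : ∀ k, IsArgMin (stepObj X (X *ᵥ β + ε) lam (b k)) {v | ∀ j ∉ supp (b k), v j = 0}
      (b (k + 1))) :
    ∃ bhat, ConvergesTo b bhat ∧ l2Norm (bhat - β) ≤ R ∧
      l1Norm (bhat - β) ≤ 4 * (√((supp β).card : ℝ) * R) ∧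
      ∀ j, SignType.sign (bhat j) = SignType.sign (β j) := by
  have hn' : (0 : ℝ) < n := by positivity
  have hβ : ∀ j ∉ supp β, β j = 0 := fun j hj => by simpa [mem_supp] using hj
  have hstep : ∀ k, IsScreened X (supp β) ε lam m (b k) → l2Norm (b (k + 1) - β) ≤ R :=
    fun k hk => step_l2Norm_le hlam hm hm1 hk hS hn hK₂ hRE hR (hpath k)
  have hscr : ∀ k, IsScreened X (supp β) ε lam m (b k) := by
    intro k
    induction k with
    | zero => exact h0
    | succ k ih =>
      have hk := hstep k ih
      have hent : ∀ j, |b (k + 1) j - β j| ≤ R := fun j => (abs_le_l2Norm _ j).trans hk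
      refine ⟨fun j hj => ?_, fun j hj => ?_, fun j hj => ?_⟩
      · have h1 := hmin j hj
        have h2 := hent j
        have h3 := abs_sub_abs_le_abs_sub (β j) (b (k + 1) j)
        rw [abs_sub_comm] at h3
        linarith
      · have := hent j
        rw [hβ j hj, sub_zero] at this
        exact this.trans hRm
      · have := hent j
        rw [hβ j hj, sub_zero] at this
        exact (mul_le_mul_of_nonneg_left this (abs_nonneg _)).trans (hu j)
  have herr : ∀ k, l2Norm (b (k + 1) - β) ≤ R := fun k => hstep k (hscr k)
  -- entries off the true support vanish after finitely many steps
  have hvanish : ∀ j ∉ supp β, ∃ k, b k j = 0 := by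
    intro j hj
    by_contra! hne
    have hdecay : ∀ k, |b k j| ≤ (1 / 2) ^ k * |b 0 j| := by
      intro k
      induction k with
      | zero => simp
      | succ k ih =>
        have := step_shrink hlam hm hm1 (hscr k) hS (hpath k) (herr k) hRm2 hj
        rw [pow_succ]
        linarith
    set M := √(n : ℝ) * (l2Norm ε + √(2 * lam / m * (√((supp β).card : ℝ) * R))) with hM
    have hres : ∀ k, |(Xᵀ *ᵥ (X *ᵥ β + ε - X *ᵥ b (k + 1))) j| ≤ M := by
      intro k
      refine (abs_transpose_mulVec_le hX hn _ j).trans ?_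
      refine mul_le_mul_of_nonneg_left ?_ (Real.sqrt_nonneg _)
      have e : X *ᵥ β + ε - X *ᵥ b (k + 1) = ε - X *ᵥ (b (k + 1) - β) := by
        rw [Matrix.mulVec_sub]; abel
      have h1 := step_inequality hlam hm hm1 (hscr k) hS (hpath k)
      have h2 : 0 ≤ ∑ j ∈ (supp β)ᶜ, 3 / 4 * (lam / |b k j|) * |(b (k + 1) - β) j| :=
        Finset.sum_nonneg fun j _ => by positivity
      have h3 : ∑ j ∈ supp β, |(b (k + 1) - β) j| ≤ √((supp β).card : ℝ) * R :=
        (sum_abs_le_sqrt_card_mul_l2Norm _ _).trans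
          (mul_le_mul_of_nonneg_left (herr k) (Real.sqrt_nonneg _))
      have h4 : l2Norm (X *ᵥ (b (k + 1) - β)) ≤ √(2 * lam / m * (√((supp β).card : ℝ) * R)) := by
        refine Real.le_sqrt_of_sq_le ?_
        have : 2 * lam / m * ∑ j ∈ supp β, |(b (k + 1) - β) j|
            ≤ 2 * lam / m * (√((supp β).card : ℝ) * R) := by gcongr
        linarith
      have h5 : l2Norm (ε - X *ᵥ (b (k + 1) - β)) ≤ l2Norm ε + l2Norm (X *ᵥ (b (k + 1) - β)) := by
        unfold l2Norm
        rw [WithLp.toLp_sub]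
        exact norm_sub_le _ _
      rw [e]
      linarith
    have hle : ∀ k : ℕ, lam ≤ M * ((1 / 2) ^ k * |b 0 j|) := by
      intro k
      have h1 := (step_weight_le hlam.le (hpath k) (hne (k + 1))).trans (hres k)
      rw [div_le_iff₀ (abs_pos.2 (hne k))] at h1
      have hM0 : 0 ≤ M := (abs_nonneg _).trans (hres k)
      exact h1.trans (mul_le_mul_of_nonneg_left (hdecay k) hM0)
    have hlim : Tendsto (fun k : ℕ => M * ((1 / 2 : ℝ) ^ k * |b 0 j|)) atTop (𝓝 0) := by
      have := ((tendsto_pow_atTop_nhds_zero_of_lt_one (r := (1 / 2 : ℝ)) (by norm_num)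
        (by norm_num)).mul_const |b 0 j|).const_mul M
      simpa using this
    exact absurd (ge_of_tendsto' hlim hle) (not_le.2 hlam)
  have hev0 : ∀ j ∉ supp β, ∀ᶠ k in atTop, b k j = 0 := by
    intro j hj
    obtain ⟨k, hk⟩ := hvanish j hj
    filter_upwards [eventually_ge_atTop k] with l hl
    induction l, hl using Nat.le_induction with
    | base => exact hk
    | succ l _ ih => exact (hpath l).1 j (by simp [mem_supp, ih])
  have hev : ∀ᶠ k in atTop, supp (b k) = supp β := by
    have h1 : ∀ᶠ k in atTop, ∀ j, j ∉ supp β → b k j = 0 := by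
      rw [eventually_all]
      intro j
      by_cases hj : j ∈ supp β
      · exact .of_forall fun k h => absurd hj h
      · exact (hev0 j hj).mono fun k h _ => h
    filter_upwards [h1] with k hk
    ext j
    constructor
    · intro h
      by_contra hj
      exact mem_supp.1 h (hk j hj)
    · intro h
      exact mem_supp.2 (abs_pos.1 (hm.trans_le ((hscr k).le_abs j h)))
  obtain ⟨k₀, hk₀⟩ := eventually_atTop.1 hev
  obtain ⟨bhat, hlim⟩ : ∃ bhat, Tendsto b atTop (𝓝 bhat) :=
    exists_tendsto_of_contraction (k₀ := k₀) fun k hk =>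
      step_contraction hlam hm hn hK₂ hRE hcontr (hk₀ k hk) (hk₀ (k + 1) (by omega))
        (hk₀ (k + 2) (by omega)) (hscr k).le_abs (hscr (k + 1)).le_abs (hpath k) (hpath (k + 1))
  have hlimj : ∀ j, Tendsto (fun k => b k j) atTop (𝓝 (bhat j)) := tendsto_pi_nhds.1 hlim
  have hge : ∀ j ∈ supp β, m ≤ |bhat j| := fun j hj =>
    ge_of_tendsto' (hlimj j).abs fun k => (hscr k).le_abs j hj
  have hzero : ∀ j ∉ supp β, bhat j = 0 := fun j hj =>
    tendsto_nhds_unique (hlimj j) (tendsto_const_nhds.congr' ((hev0 j hj).mono fun k h => h.symm))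
  have hsupp : supp bhat = supp β := by
    ext j
    constructor
    · intro h
      by_contra hj
      exact mem_supp.1 h (hzero j hj)
    · intro h
      exact mem_supp.2 (abs_pos.1 (hm.trans_le (hge j h)))
  have hR2 : l2Norm (bhat - β) ≤ R := by
    have h1 : Tendsto (fun k => b (k + 1) - β) atTop (𝓝 (bhat - β)) :=
      ((tendsto_add_atTop_iff_nat 1).2 hlim).sub_const β
    have h2 : Tendsto (fun k => l2Norm (b (k + 1) - β)) atTop (𝓝 (l2Norm (bhat - β))) :=
      (continuous_l2Norm.tendsto _).comp h1
    exact le_of_tendsto' h2 herr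
  refine ⟨bhat, ⟨hlim, by rwa [hsupp]⟩, hR2, ?_, fun j => ?_⟩
  · rw [l1Norm_eq_sum, ← Finset.sum_add_sum_compl (supp β)]
    have h1 : ∑ j ∈ (supp β)ᶜ, |(bhat - β) j| = 0 := Finset.sum_eq_zero fun j hj => by
      have hj' := Finset.mem_compl.1 hj
      simp [hzero j hj', hβ j hj']
    have h2 := sum_abs_le_sqrt_card_mul_l2Norm (supp β) (bhat - β)
    have h3 : √((supp β).card : ℝ) * l2Norm (bhat - β) ≤ √((supp β).card : ℝ) * R := by gcongr
    have h4 : 0 ≤ √((supp β).card : ℝ) * l2Norm (bhat - β) :=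
      mul_nonneg (Real.sqrt_nonneg _) (l2Norm_nonneg _)
    linarith
  · by_cases hj : j ∈ supp β
    · have h1 := abs_le.1 ((abs_le_l2Norm (bhat - β) j).trans hR2)
      rw [Pi.sub_apply] at h1
      have h2 := hmin j hj
      rcases lt_trichotomy (β j) 0 with h | h | h
      · rw [abs_of_neg h] at h2
        rw [sign_neg h, sign_neg (by linarith)]
      · exact absurd h (mem_supp.1 hj)
      · rw [abs_of_pos h] at h2
        rw [sign_pos h, sign_pos (by linarith)]
    · rw [hzero j hj, hβ j hj]

end Path

/-! ### The deterministic analysis on favourable noise -/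

/-- The asymptotic relations between sample size, dimension, sparsity and signal strength, with a
small number `ρ`. Here `κ` stands for `n ^ ((c₃ - 1) / 2)`, the order of the smallest signal. -/
structure Scale (n p q : ℕ) (ρ κ : ℝ) : Prop where
  pos : 0 < κ
  dim : √(q : ℝ) * √(Real.log p) ≤ ρ * √(n : ℝ) * κ
  sparsity : q * √(Real.log n) ≤ ρ * √(n : ℝ) * κ ^ 2
  log_le : Real.log n ≤ ρ * √(n : ℝ) * κ
  contraction : √(Real.log n) ≤ ρ * √(n : ℝ) * κ ^ 2
  signal : √(Real.log n) * κ ≤ ρ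
  large : 1 ≤ ρ * √(Real.log n)

/-- Sufficient smallness of `η`, the relative entrywise accuracy of the iterates, and of `ρ`. The
number `K` is the lower bound, in units of `κ`, for the entries of the iterates on the true
support. -/
structure Smallness (σ K K₁ K₂ η ρ : ℝ) : Prop where
  K_pos : 0 < K
  η_pos : 0 < η
  η_le_K : 16 * η ≤ 3 * K
  η_add_le : K + η ≤ K₁
  η_le : 8 * η ≤ 1
  η_le_σ : η ≤ σ
  ρ_pos : 0 < ρ
  ρ_le : 4 * ρ ≤ 1
  ρ_mul_K : K * ρ ≤ 1
  ρ_mul_σ : 3 * (σ * ρ) ≤ 1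
  ρ_le_η : 23 * (σ * ρ) ≤ η
  ρ_le_K₂ : 25 * (σ * ρ) ≤ η * K₂
  ρ_le_K : 8 * (σ * ρ) ≤ η * (K * K₂)

lemma exists_smallness {σ K₁ K₂ K₃ : ℝ} (hσ : 0 < σ) (hK₂ : 0 < K₂) (hK₃ : 0 < K₃)
    (hK : K₃ < K₁) : ∃ K η ρ, K₃ ≤ K ∧ Smallness σ K K₁ K₂ η ρ := by
  set K := (K₁ + K₃) / 2 with hKdef
  have hKpos : 0 < K := by linarith
  set η := min (min (3 / 16 * K) ((K₁ - K₃) / 2)) (min (1 / 8) σ) with hη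
  have hη0 : 0 < η := by
    refine lt_min (lt_min (by positivity) (by linarith)) (lt_min (by norm_num) hσ)
  have h1 : η ≤ 3 / 16 * K := (min_le_left _ _).trans (min_le_left _ _)
  have h2 : η ≤ (K₁ - K₃) / 2 := (min_le_left _ _).trans (min_le_right _ _)
  have h3 : η ≤ 1 / 8 := (min_le_right _ _).trans (min_le_left _ _)
  have h4 : η ≤ σ := (min_le_right _ _).trans (min_le_right _ _)
  obtain ⟨ρ, hρ0, r1, r2, r3, r4, r5, r6⟩ : ∃ ρ : ℝ, 0 < ρ ∧ ρ ≤ 1 / 4 ∧ ρ ≤ 1 / K ∧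
      ρ ≤ 1 / (3 * σ) ∧ ρ ≤ η / (23 * σ) ∧ ρ ≤ η * K₂ / (25 * σ) ∧ ρ ≤ η * (K * K₂) / (8 * σ) := by
    refine ⟨min (min (min (1 / 4) (1 / K)) (1 / (3 * σ)))
      (min (min (η / (23 * σ)) (η * K₂ / (25 * σ))) (η * (K * K₂) / (8 * σ))), ?_, ?_⟩
    · simp only [lt_min_iff]
      refine ⟨⟨⟨?_, ?_⟩, ?_⟩, ⟨?_, ?_⟩, ?_⟩ <;> positivity
    · simp only [min_le_iff, le_refl, true_or, or_true, and_self]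
  rw [le_div_iff₀ (by positivity)] at r2 r3 r4 r5 r6
  exact ⟨K, η, ρ, by linarith, hKpos, hη0, by linarith, by linarith, by linarith, h4, hρ0,
    by linarith, by linarith, by linarith, by linarith, by linarith, by linarith⟩

section Deterministic

variable {n p : ℕ} {X : Matrix (Fin n) (Fin p) ℝ} {β b₀ : Fin p → ℝ} {ε : Fin n → ℝ}
  {lam0 lam σ K K₁ K₂ η ρ κ s U : ℝ} {T : Finset (Fin p)}

lemma Scale.one_le_sqrt_log {n p q : ℕ} (h : Scale n p q ρ κ) (hρ : Smallness σ K K₁ K₂ η ρ) :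
    1 ≤ √(Real.log n) := by
  nlinarith [h.large, hρ.ρ_le, hρ.ρ_pos, Real.sqrt_nonneg (Real.log n)]

lemma Scale.κ_le {n p q : ℕ} (h : Scale n p q ρ κ) (hρ : Smallness σ K K₁ K₂ η ρ) : κ ≤ ρ := by
  nlinarith [h.signal, h.one_le_sqrt_log hρ, h.pos]

lemma Scale.sq_sqrt_log {n p q : ℕ} (_ : Scale n p q ρ κ) :
    √(Real.log n) ^ 2 = Real.log n := Real.sq_sqrt (Real.log_natCast_nonneg n)

lemma four_fifths_le_sqrt_log (hp : 2 ≤ p) : 4 / 5 ≤ √(Real.log p) := by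
  refine Real.le_sqrt_of_sq_le ?_
  have : Real.log 2 ≤ Real.log p := Real.log_le_log (by norm_num) (by exact_mod_cast hp)
  linarith [Real.log_two_gt_d9]

/-- On favourable noise the Lasso error is entrywise small compared with the signals. -/
lemma lasso_entry_error (hX : Standardized X) (hn : 0 < n) (hσ : 0 < σ) (hK₂ : 0 < K₂)
    (hRE : RestrictedEigenvalue (gram X) (supp β) K₂)
    (hsc : Scale n p (supp β).card ρ κ) (hsm : Smallness σ K K₁ K₂ η ρ)
    (hlam0 : lam0 = 4 * σ * (√(n : ℝ) * √(Real.log p)))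
    (hT : p ≤ 1 → T = Finset.univ) (hε : FavourableNoise X β T lam0 σ s U ε)
    (hb : IsArgMin (lassoObj X (X *ᵥ β + ε) lam0) Set.univ b₀) (j : Fin p) :
    |(b₀ - β) j| ≤ η * κ := by
  have hn' : (0 : ℝ) < n := by positivity
  set r := √(n : ℝ) with hr
  have hr0 : 0 < r := Real.sqrt_pos.2 hn'
  have hr2 : (n : ℝ) = r ^ 2 := (Real.sq_sqrt hn'.le).symm
  set l := √(Real.log n) with hl
  have hl2 : Real.log n = l ^ 2 := hsc.sq_sqrt_log.symm
  have hl1 : 1 ≤ l := hsc.one_le_sqrt_log hsm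
  have hκ := hsc.pos
  have hρ0 := hsm.ρ_pos
  have hlog : l ^ 2 ≤ ρ * r * κ := by rw [← hl2]; exact hsc.log_le
  have hlam00 : 0 ≤ lam0 := by rw [hlam0]; positivity
  rcases le_or_gt p 1 with hp | hp
  · have hlam0' : lam0 = 0 := by
      have : Real.log p = 0 := by interval_cases p <;> simp
      rw [hlam0, this]; simp
    rw [hlam0'] at hb
    have h1 := least_squares_error hX hn hp hb j
    have h2 := hε.score j (by rw [hT hp]; exact Finset.mem_univ j)
    have h3 : √(6 * n * Real.log n) ≤ 3 * r * l := by
      refine Real.sqrt_le_iff.2 ⟨by positivity, ?_⟩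
      rw [hl2, hr2, mul_pow, mul_pow]
      nlinarith [mul_nonneg (sq_nonneg r) (sq_nonneg l)]
    have h4 : r * (r * |(b₀ - β) j|) ≤ r * (3 * σ * l) := by
      have : (n : ℝ) * |(b₀ - β) j| = |(Xᵀ *ᵥ ε) j| := by
        rw [← h1, abs_mul, abs_of_pos hn']
      calc r * (r * |(b₀ - β) j|) = (n : ℝ) * |(b₀ - β) j| := by rw [hr2]; ring
        _ ≤ σ * √(6 * n * Real.log n) := by rw [this]; exact h2
        _ ≤ σ * (3 * r * l) := by gcongr
        _ = r * (3 * σ * l) := by ring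
    have h5 := le_of_mul_le_mul_left h4 hr0
    have h6 : r * |(b₀ - β) j| ≤ r * (η * κ) := by
      have e1 : l ≤ ρ * r * κ := by nlinarith
      have e2 : 3 * σ * l ≤ 3 * σ * (ρ * r * κ) := by gcongr
      have e3 : 3 * (σ * ρ) * (r * κ) ≤ η * (r * κ) :=
        mul_le_mul_of_nonneg_right (by nlinarith [hsm.ρ_le_η, mul_pos hσ hρ0]) (by positivity)
      linarith
    exact le_of_mul_le_mul_left h6 hr0
  · obtain ⟨ε', hε'1, hε'2⟩ := hε.near hp
    have hd := four_fifths_le_sqrt_log (p := p) hp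
    rcases lasso_error_dichotomy hlam00 hn hRE hb hε'1 hε'2 with ⟨-, hcone⟩ | hout
    · refine (abs_le_l2Norm _ j).trans ?_
      by_contra! hlt
      set x := l2Norm (b₀ - β)
      have hx0 : 0 < x := lt_trans (mul_pos hsm.η_pos hκ) hlt
      have e1 : 12 * σ ^ 2 * Real.log n ≤ 12 * (σ * ρ) ^ 2 * (r * κ) ^ 2 := by
        have : l ^ 2 ≤ (ρ * r * κ) ^ 2 := by
          have : 1 ≤ l ^ 2 := by nlinarith
          nlinarith
        rw [hl2]
        nlinarith [sq_nonneg σ]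
      have e2 : 3 * lam0 * (√((supp β).card : ℝ) * x) ≤ 12 * (σ * ρ) * (r * κ) * (r * x) := by
        rw [hlam0]
        have := mul_le_mul_of_nonneg_left hsc.dim (show 0 ≤ 12 * σ * (r * x) by positivity)
        linarith
      have e3 : K₂ * (r * x) ^ 2
          ≤ 12 * ((σ * ρ) * (r * κ)) ^ 2 + 12 * ((σ * ρ) * (r * κ)) * (r * x) := by
        have hcone' : r ^ 2 * K₂ * x ^ 2 ≤ 12 * σ ^ 2 * Real.log n
            + 3 * lam0 * (√((supp β).card : ℝ) * x) := by rw [← hr2]; exact hcone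
        linarith
      have e4 : 25 * ((σ * ρ) * (r * κ)) ≤ K₂ * (r * x) := by
        have h1 := mul_le_mul_of_nonneg_right hsm.ρ_le_K₂ (mul_pos hr0 hκ).le
        have h2 := mul_le_mul_of_nonneg_left hlt.le (mul_pos hK₂ hr0).le
        linarith
      have e5 : (σ * ρ) * (r * κ) ≤ r * x := by
        have h1 := mul_le_mul_of_nonneg_right hsm.ρ_le_η (mul_pos hr0 hκ).le
        have h2 := mul_le_mul_of_nonneg_left hlt.le hr0.le
        have h3 : 0 < σ * ρ * (r * κ) := by positivity
        linarith
      have hw : 0 < (σ * ρ) * (r * κ) := by positivity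
      have hz : 0 < r * x := by positivity
      nlinarith
    · have h1 := hout j
      rw [hlam0, hl2] at h1
      have h2 : 4 * σ * (r * (4 / 5)) * |(b₀ - β) j| ≤ 6 * (12 * σ ^ 2 * (ρ * r * κ)) := by
        calc 4 * σ * (r * (4 / 5)) * |(b₀ - β) j|
            ≤ 4 * σ * (r * √(Real.log p)) * |(b₀ - β) j| := by gcongr
          _ ≤ 6 * (12 * σ ^ 2 * l ^ 2) := h1
          _ ≤ 6 * (12 * σ ^ 2 * (ρ * r * κ)) := by gcongr
      have h3 : (σ * r) * |(b₀ - β) j| ≤ (σ * r) * (23 * (σ * ρ) * κ) := by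
        have : 0 < σ ^ 2 * (ρ * r * κ) := by positivity
        nlinarith
      have h4 := le_of_mul_le_mul_left h3 (by positivity)
      exact h4.trans (mul_le_mul_of_nonneg_right hsm.ρ_le_η hκ.le)

/-- A uniform bound for the correlations of the columns with favourable noise. -/
lemma score_le (hX : Standardized X) (hn : 0 < n) (hσ : 0 < σ)
    (hlam0 : lam0 = 4 * σ * (√(n : ℝ) * √(Real.log p)))
    (hlam : lam = 4 * σ * (√(n : ℝ) * √(Real.log n)))
    (hT : p ≤ 1 → T = Finset.univ) (hε : FavourableNoise X β T lam0 σ s U ε) (j : Fin p) :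
    |(Xᵀ *ᵥ ε) j| ≤ 1 / 2 * lam0 + lam := by
  have hn' : (0 : ℝ) < n := by positivity
  have hlam00 : 0 ≤ lam0 := by rw [hlam0]; positivity
  have hlogn := Real.log_natCast_nonneg n
  rcases le_or_gt p 1 with hp | hp
  · have h2 := hε.score j (by rw [hT hp]; exact Finset.mem_univ j)
    have h3 : √(6 * n * Real.log n) ≤ 4 * (√(n : ℝ) * √(Real.log n)) := by
      rw [← Real.sqrt_mul hn'.le]
      refine Real.sqrt_le_iff.2 ⟨by positivity, ?_⟩
      rw [mul_pow, Real.sq_sqrt (by positivity)]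
      nlinarith [mul_nonneg hn'.le hlogn]
    rw [hlam]
    nlinarith
  · obtain ⟨ε', h1, h2⟩ := hε.near hp
    have h3 := abs_transpose_mulVec_le hX hn (ε - ε') j
    have h4 : l2Norm (ε - ε') ≤ 4 * σ * √(Real.log n) := by
      refine (abs_le_of_sq_le_sq' (h2.trans ?_) (by positivity)).2
      rw [mul_pow, mul_pow, Real.sq_sqrt hlogn]
      nlinarith [mul_nonneg (sq_nonneg σ) hlogn]
    have h5 : (Xᵀ *ᵥ ε) j = (Xᵀ *ᵥ ε') j + (Xᵀ *ᵥ (ε - ε')) j := by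
      rw [Matrix.mulVec_sub, Pi.sub_apply]; ring
    rw [h5]
    have h6 : √(n : ℝ) * l2Norm (ε - ε') ≤ lam := by
      rw [hlam]
      calc √(n : ℝ) * l2Norm (ε - ε') ≤ √(n : ℝ) * (4 * σ * √(Real.log n)) := by gcongr
        _ = _ := by ring
    linarith [abs_add_le ((Xᵀ *ᵥ ε') j) ((Xᵀ *ᵥ (ε - ε')) j), h1 j]

lemma score_on_supp_le (hn : 0 < n) (hσ : 0 < σ)
    (hlam : lam = 4 * σ * (√(n : ℝ) * √(Real.log n)))
    (hε : FavourableNoise X β T lam0 σ s U ε) (j : Fin p) (hj : j ∈ T) :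
    |(Xᵀ *ᵥ ε) j| ≤ lam := by
  have hn' : (0 : ℝ) < n := by positivity
  have hlogn := Real.log_natCast_nonneg n
  have h3 : √(6 * n * Real.log n) ≤ 4 * (√(n : ℝ) * √(Real.log n)) := by
    rw [← Real.sqrt_mul hn'.le]
    refine Real.sqrt_le_iff.2 ⟨by positivity, ?_⟩
    rw [mul_pow, Real.sq_sqrt (by positivity)]
    nlinarith [mul_nonneg hn'.le hlogn]
  rw [hlam]
  nlinarith [hε.score j hj]

/-- Off the true support, the product of a Lasso entry with the correlation of its column with
the noise is small compared with `lam`. For `p` polynomial in `n` this follows from bounds on both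
factors. For larger `p` the correlation can be far larger than `lam`, and the shift argument for
the Lasso solution is needed. -/
lemma lasso_noise_product (hX : Standardized X) (hn : 0 < n) (hσ : 0 < σ) (hK₂ : 0 < K₂)
    (hRE : RestrictedEigenvalue (gram X) (supp β) K₂)
    (hsc : Scale n p (supp β).card ρ κ) (hsm : Smallness σ K K₁ K₂ η ρ)
    (hlam0 : lam0 = 4 * σ * (√(n : ℝ) * √(Real.log p)))
    (hlam : lam = 4 * σ * (√(n : ℝ) * √(Real.log n)))
    (hT : p ≤ 1 → T = Finset.univ)
    (hε : FavourableNoise X β T lam0 σ (1 / (√(n : ℝ) * κ)) (√(n : ℝ) / κ) ε)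
    (hb : IsArgMin (lassoObj X (X *ᵥ β + ε) lam0) Set.univ b₀) {j : Fin p} (hj : j ∉ supp β) :
    |(Xᵀ *ᵥ ε) j| * |b₀ j| ≤ lam / 4 := by
  have hn' : (0 : ℝ) < n := by positivity
  set r := √(n : ℝ) with hr
  have hr0 : 0 < r := Real.sqrt_pos.2 hn'
  set l := √(Real.log n) with hl
  have hl1 : 1 ≤ l := hsc.one_le_sqrt_log hsm
  have hκ := hsc.pos
  have hκρ := hsc.κ_le hsm
  have hρ0 := hsm.ρ_pos
  have hη0 := hsm.η_pos
  have hβ : β j = 0 := by simpa [mem_supp] using hj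
  have hlam00 : 0 ≤ lam0 := by rw [hlam0]; positivity
  have hlampos : 0 < lam := by rw [hlam]; positivity
  have hentry : |b₀ j| ≤ η * κ := by
    have := lasso_entry_error hX hn hσ hK₂ hRE hsc hsm hlam0 hT hε hb j
    simpa [hβ] using this
  have hκ1 : κ ≤ 1 := by linarith [hsm.ρ_le]
  rcases le_or_gt p (n ^ 4) with hp | hp
  · have h1 := score_le hX hn hσ hlam0 hlam hT hε j
    have h2 : lam0 ≤ 2 * lam := by
      have : √(Real.log p) ≤ 2 * l := by
        refine Real.sqrt_le_iff.2 ⟨by positivity, ?_⟩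
        rw [mul_pow, hsc.sq_sqrt_log]
        rcases Nat.eq_zero_or_pos p with rfl | hp0
        · exact j.elim0
        · have h3 : Real.log p ≤ Real.log ((n : ℝ) ^ 4) :=
            Real.log_le_log (by exact_mod_cast hp0) (by exact_mod_cast hp)
          rw [Real.log_pow] at h3
          push_cast at h3
          linarith
      have h4 : 4 * σ * (r * √(Real.log p)) ≤ 4 * σ * (r * (2 * l)) := by gcongr
      rw [hlam0, hlam]
      linarith
    have h3 : |b₀ j| ≤ 1 / 8 := by nlinarith [hsm.η_le]
    calc |(Xᵀ *ᵥ ε) j| * |b₀ j| ≤ (2 * lam) * (1 / 8) := by gcongr; linarith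
      _ = lam / 4 := by ring
  · have hp1 : 2 ≤ p := by
      have := Nat.one_le_pow 4 n hn
      omega
    have hlam0pos : 0 < lam0 := by
      have := four_fifths_le_sqrt_log (p := p) hp1
      rw [hlam0]; positivity
    rcases (supp β).card.eq_zero_or_pos with hq | hq
    · -- without signals, the Lasso solution vanishes
      have hS : supp β = ∅ := Finset.card_eq_zero.1 hq
      have h0 : |b₀ j| = 0 := by
        rcases lasso_error_dichotomy (E := 0) hlam00 hn hRE hb (hε.small hp)
          (by rw [sub_self]; simp [l2Norm_sq]) with ⟨hcone, -⟩ | hout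
        · rw [hS, Finset.compl_empty, Finset.sum_empty, mul_zero] at hcone
          have := Finset.single_le_sum (f := fun j => |(b₀ - β) j|) (fun j _ => abs_nonneg _)
            (Finset.mem_univ j)
          rw [Pi.sub_apply, hβ, sub_zero] at this
          exact le_antisymm (this.trans hcone) (abs_nonneg _)
        · have := hout j
          rw [mul_zero, Pi.sub_apply, hβ, sub_zero] at this
          exact le_antisymm (nonpos_of_mul_nonpos_right this hlam0pos) (abs_nonneg _)
      rw [h0, mul_zero]
      positivity
    · by_contra! hlt
      have hu := hε.small hp j
      have hu0 : 0 ≤ |(Xᵀ *ᵥ ε) j| := abs_nonneg _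
      have hdim : √(Real.log p) ≤ ρ * r * κ := by
        have h1 : 1 ≤ √((supp β).card : ℝ) := Real.one_le_sqrt.2 (by exact_mod_cast hq)
        exact (le_mul_of_one_le_left (Real.sqrt_nonneg _) h1).trans hsc.dim
      -- a large product forces a large entry, as the correlation is at most of order `lam0`
      have hbig : 2 * (1 / (r * κ)) ≤ |b₀ j| := by
        by_contra! hsmall
        have h1 : |(Xᵀ *ᵥ ε) j| * |b₀ j| ≤ 7 / 16 * lam0 * (2 * (1 / (r * κ))) := by gcongr
        have h2 : 7 / 16 * lam0 * (2 * (1 / (r * κ))) ≤ 7 / 2 * (σ * ρ) * r := by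
          have h3 : lam0 ≤ 4 * σ * (r * (ρ * r * κ)) := by rw [hlam0]; gcongr
          calc 7 / 16 * lam0 * (2 * (1 / (r * κ)))
              ≤ 7 / 16 * (4 * σ * (r * (ρ * r * κ))) * (2 * (1 / (r * κ))) := by gcongr
            _ = 7 / 2 * (σ * ρ) * r := by field_simp; ring
        have h4 : σ * r ≤ lam / 4 := by
          rw [hlam]
          have : σ * r * 1 ≤ σ * r * l := by gcongr
          linarith
        have h5 : 7 / 2 * (σ * ρ) * r ≤ 7 / 8 * (σ * r) := by
          have := mul_le_mul_of_nonneg_left hsm.ρ_le (mul_pos hσ hr0).le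
          linarith
        have : 0 < σ * r := by positivity
        linarith
      have hsign : ∀ x : ℝ, ∃ τ : ℝ, (τ = 1 ∨ τ = -1) ∧ τ * x = |x| := fun x => by
        rcases le_total 0 x with h | h
        · exact ⟨1, .inl rfl, by rw [abs_of_nonneg h, one_mul]⟩
        · exact ⟨-1, .inr rfl, by rw [abs_of_nonpos h]; ring⟩
      obtain ⟨τ, hτ, hτb⟩ := hsign (b₀ j)
      obtain ⟨τ', hτ', hτu⟩ := hsign ((Xᵀ *ᵥ ε) j)
      have hmem : ε ∈ largeEntrySet X β lam0 τ (2 * (1 / (r * κ))) j := by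
        refine ⟨b₀, fun z => ?_, by rw [hτb]; exact hbig⟩
        rw [← lassoObj_eq_penObj, ← lassoObj_eq_penObj]
        rcases eq_or_ne z b₀ with rfl | hne
        · exact le_rfl
        · exact (hb.2 z trivial hne).le
      have hent := hε.entry hp τ τ' hτ hτ' j hmem
      rw [hτu] at hent
      have h1 : |(Xᵀ *ᵥ ε) j| * |b₀ j| ≤ r / κ * (η * κ) := by gcongr
      have h2 : r / κ * (η * κ) = η * r := by
        rw [div_mul_eq_mul_div, div_eq_iff hκ.ne']; ring
      have h3 : η * r ≤ σ * r * l := by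
        calc η * r ≤ σ * r := by gcongr; exact hsm.η_le_σ
          _ ≤ σ * r * l := le_mul_of_one_le_right (by positivity) hl1
      rw [hlam] at hlt
      linarith

/-- Everything that the theorem asserts about the iterates holds on favourable noise. -/
lemma path_converges_of_favourableNoise (hX : Standardized X) (hn : 0 < n) (hσ : 0 < σ)
    (hK₂ : 0 < K₂) (hRE : RestrictedEigenvalue (gram X) (supp β) K₂)
    (hmin : ∀ j ∈ supp β, K₁ * κ < |β j|)
    (hsc : Scale n p (supp β).card ρ κ) (hsm : Smallness σ K K₁ K₂ η ρ)
    (hlam0 : lam0 = 4 * σ * (√(n : ℝ) * √(Real.log p)))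
    (hlam : lam = 4 * σ * (√(n : ℝ) * √(Real.log n)))
    (hT : p ≤ 1 → T = Finset.univ) (hST : supp β ⊆ T)
    (hε : FavourableNoise X β T lam0 σ (1 / (√(n : ℝ) * κ)) (√(n : ℝ) / κ) ε)
    {b : ℕ → Fin p → ℝ} (hb : IsMSPPath X (X *ᵥ β + ε) lam0 lam b) :
    ∃ bhat, ConvergesTo b bhat ∧
      l2Norm (bhat - β) ≤ 8 * σ / (K₂ * K) *
        (√((supp β).card : ℝ) * √(Real.log n) / (√(n : ℝ) * κ)) ∧
      l1Norm (bhat - β) ≤ 4 * (√((supp β).card : ℝ) * (8 * σ / (K₂ * K) *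
        (√((supp β).card : ℝ) * √(Real.log n) / (√(n : ℝ) * κ)))) ∧
      ∀ j, SignType.sign (bhat j) = SignType.sign (β j) := by
  have hn' : (0 : ℝ) < n := by positivity
  have hscore := score_le hX hn hσ hlam0 hlam hT hε
  have hentry := lasso_entry_error hX hn hσ hK₂ hRE hsc hsm hlam0 hT hε hb.1
  have hprod := fun j hj =>
    lasso_noise_product hX hn hσ hK₂ hRE hsc hsm hlam0 hlam hT hε hb.1 (j := j) hj
  have hsupp := fun j hj => score_on_supp_le hn hσ hlam hε j (hST hj)
  set r := √(n : ℝ) with hr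
  have hr0 : 0 < r := Real.sqrt_pos.2 hn'
  have hr2 : (n : ℝ) = r ^ 2 := (Real.sq_sqrt hn'.le).symm
  set l := √(Real.log n) with hl
  have hl1 : 1 ≤ l := hsc.one_le_sqrt_log hsm
  have hκ := hsc.pos
  have hκρ := hsc.κ_le hsm
  have hρ0 := hsm.ρ_pos
  have hη0 := hsm.η_pos
  have hK := hsm.K_pos
  set q := (supp β).card with hq
  set w := √(q : ℝ) with hw
  have hw0 : 0 ≤ w := Real.sqrt_nonneg _
  have hw2 : w * w = q := Real.mul_self_sqrt (Nat.cast_nonneg q)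
  have hlampos : 0 < lam := by rw [hlam]; positivity
  have hκ1 : κ ≤ 1 := by linarith [hsm.ρ_le]
  have hβ : ∀ j ∉ supp β, β j = 0 := fun j hj => by simpa [mem_supp] using hj
  set R := 8 * σ / (K₂ * K) * (w * l / (r * κ)) with hR
  have hR0 : 0 ≤ R := mul_nonneg (div_nonneg (mul_nonneg (by norm_num) hσ.le)
    (mul_nonneg hK₂.le hK.le)) (div_nonneg (mul_nonneg hw0 (Real.sqrt_nonneg _))
    (mul_nonneg hr0.le hκ.le))
  have hηκ : η * κ ≤ 1 / 8 := by nlinarith [hsm.η_le]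
  -- the sparsity relation bounds the rate, even after multiplication by `√q`
  have hwR : w * R ≤ η * κ := by
    have h1 : w * R = 8 * σ / (K₂ * K) * (q * l / (r * κ)) := by
      rw [hR, ← hw2]; ring
    have h2 : q * l / (r * κ) ≤ ρ * κ := by
      rw [div_le_iff₀ (by positivity)]
      calc q * l ≤ ρ * r * κ ^ 2 := hsc.sparsity
        _ = ρ * κ * (r * κ) := by ring
    have h3 : 8 * σ / (K₂ * K) * (ρ * κ) ≤ η * κ := by
      have : 8 * σ / (K₂ * K) * ρ ≤ η := by
        rw [div_mul_eq_mul_div, div_le_iff₀ (by positivity)]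
        linarith [hsm.ρ_le_K]
      nlinarith
    rw [h1]
    exact (mul_le_mul_of_nonneg_left h2 (by positivity)).trans h3
  have hRη : R ≤ η * κ := by
    rcases Nat.eq_zero_or_pos q with h0 | h0
    · have : R = 0 := by rw [hR, hw, h0]; simp
      rw [this]; positivity
    · have h1 : 1 ≤ w := Real.one_le_sqrt.2 (by exact_mod_cast h0)
      exact (le_mul_of_one_le_left hR0 h1).trans hwR
  have hm1 : K * κ ≤ 1 := (mul_le_mul_of_nonneg_left hκρ hK.le).trans hsm.ρ_mul_K
  have hηK : η * κ ≤ K * κ := by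
    have : η ≤ K := by linarith [hsm.η_le_K]
    gcongr
  have hKη : K * κ + η * κ ≤ K₁ * κ := by
    rw [← add_mul]
    exact mul_le_mul_of_nonneg_right hsm.η_add_le hκ.le
  refine path_converges (m := K * κ) (R := R) hX hn hlampos (mul_pos hK hκ) hm1 hK₂ hRE hsupp ?_
    (fun j hj => by linarith [hmin j hj]) (by linarith) (fun j => ?_) ?_ ?_ ?_ hb.2
  · rw [hR, hlam, hr2, div_mul_div_comm, mul_div_assoc', div_mul_eq_mul_div,
      div_eq_div_iff (by positivity) (by positivity)]
    ring
  · have h1 : lam0 * R ≤ η * lam := by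
      have h2 : lam0 * R = 32 * σ ^ 2 / (K₂ * K) * ((w * √(Real.log p)) * (l / κ)) := by
        rw [hlam0, hR]
        field_simp
        ring
      have h3 : (w * √(Real.log p)) * (l / κ) ≤ (ρ * r * κ) * (l / κ) :=
        mul_le_mul_of_nonneg_right hsc.dim (by positivity)
      have h4 : (ρ * r * κ) * (l / κ) = ρ * r * l := by field_simp
      have h5 : 32 * σ ^ 2 / (K₂ * K) * (ρ * r * l) ≤ η * lam := by
        rw [hlam, div_mul_eq_mul_div, div_le_iff₀ (by positivity)]
        have := mul_le_mul_of_nonneg_left hsm.ρ_le_K (show 0 ≤ 4 * σ * (r * l) by positivity)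
        linarith
      rw [h2]
      refine (mul_le_mul_of_nonneg_left (h3.trans_eq h4) (by positivity)).trans h5
    have h2 : |(Xᵀ *ᵥ ε) j| * R ≤ (1 / 2 * lam0 + lam) * R :=
      mul_le_mul_of_nonneg_right (hscore j) hR0
    have h3 : lam * R ≤ lam * (1 / 8) := by gcongr; linarith
    have h4 : η * lam ≤ 1 / 8 * lam := by gcongr; linarith [hsm.η_le]
    linarith
  · have := mul_le_mul_of_nonneg_right hsm.η_le_K hκ.le
    linarith
  · have h1 : 8 * (σ * ρ) ≤ K₂ * K ^ 2 := by
      have h2 : η ≤ K := by linarith [hsm.η_le_K]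
      have h3 : η * (K * K₂) ≤ K * (K * K₂) := by gcongr
      linarith [hsm.ρ_le_K]
    rw [hlam, hr2]
    calc 2 * (4 * σ * (r * l)) ≤ 2 * (4 * σ * (r * (ρ * r * κ ^ 2))) := by
          gcongr; exact hsc.contraction
      _ = 8 * (σ * ρ) * (r ^ 2 * κ ^ 2) := by ring
      _ ≤ K₂ * K ^ 2 * (r ^ 2 * κ ^ 2) := by gcongr
      _ = r ^ 2 * K₂ * (K * κ) ^ 2 := by ring
  · refine ⟨fun j hj => ?_, fun j hj => ?_, hprod⟩
    · have h1 := hentry j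
      have h2 := abs_sub_abs_le_abs_sub (β j) (b 0 j)
      rw [abs_sub_comm] at h2
      rw [Pi.sub_apply] at h1
      linarith [hmin j hj]
    · have h1 := hentry j
      rw [Pi.sub_apply, hβ j hj, sub_zero] at h1
      linarith

end Deterministic

/-! ### Asymptotics and probability -/

lemma eventually_mul_log_le_rpow (C : ℝ) {r : ℝ} (hr : 0 < r) :
    ∀ᶠ n : ℕ in atTop, C * Real.log n ≤ (n : ℝ) ^ r := by
  have h := (isLittleO_log_rpow_atTop hr).bound (c := 1 / (|C| + 1)) (by positivity)
  filter_upwards [tendsto_natCast_atTop_atTop.eventually h, eventually_ge_atTop 1] with n hn hn1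
  have h1 : 0 ≤ Real.log n := Real.log_natCast_nonneg n
  rw [Real.norm_of_nonneg h1, Real.norm_of_nonneg (by positivity), one_div_mul_eq_div,
    le_div_iff₀ (by positivity)] at hn
  nlinarith [le_abs_self C]

/-- For large samples all relations in `Scale` hold, with an arbitrarily small `ρ`. -/
lemma eventually_scale {c₁ c₂ c₃ : ℝ} (M₁ M₂ : ℝ) {ρ : ℝ} (hρ : 0 < ρ) (hc₁₂ : c₁ + c₂ < c₃)
    (hc₃_half : 1 / 2 < c₃) (hc₂₃ : (1 + 3 * c₂) / 2 < c₃) (hc₃ : c₃ < 1) :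
    ∀ᶠ n : ℕ in atTop, 8 ≤ n ∧ ∀ p q : ℕ, (p : ℝ) ≤ M₁ * Real.exp ((n : ℝ) ^ c₁) →
      (q : ℝ) ≤ M₂ * (n : ℝ) ^ c₂ → Scale n p q ρ ((n : ℝ) ^ ((c₃ - 1) / 2)) := by
  have hc₂ : c₂ < c₃ - 1 / 2 := by
    rcases le_or_gt 0 c₂ with h | h <;> linarith
  set M := max M₁ 1 with hM
  have hlogM : 0 ≤ Real.log M := Real.log_nonneg (le_max_right _ _)
  have hlog : ∀ B : ℝ, ∀ᶠ n : ℕ in atTop, B ≤ Real.log n := fun B =>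
    (Real.tendsto_log_atTop.comp tendsto_natCast_atTop_atTop).eventually (eventually_ge_atTop B)
  filter_upwards [eventually_ge_atTop 8, hlog 1, hlog (1 / ρ ^ 2),
    eventually_mul_log_le_rpow (2 * |M₂| * Real.log M / ρ ^ 2) (r := c₃ - c₂) (by linarith),
    eventually_mul_log_le_rpow (2 * |M₂| / ρ ^ 2) (r := c₃ - (c₁ + c₂)) (by linarith),
    eventually_mul_log_le_rpow (|M₂| / ρ) (r := c₃ - 1 / 2 - c₂) (by linarith),
    eventually_mul_log_le_rpow (1 / ρ) (r := c₃ / 2) (by linarith),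
    eventually_mul_log_le_rpow (1 / ρ) (r := c₃ - 1 / 2) (by linarith),
    eventually_mul_log_le_rpow (1 / ρ) (r := (1 - c₃) / 2) (by linarith)]
    with n hn8 hL1 hLρ h1 h2 h3 h4 h5 h6
  have hn : (0 : ℝ) < n := by
    have : 0 < n := by omega
    exact_mod_cast this
  set L := Real.log n with hL
  have hsqrtL : √L ≤ L := Real.sqrt_le_iff.2 ⟨by linarith, by nlinarith⟩
  have hκ1 : √(n : ℝ) * (n : ℝ) ^ ((c₃ - 1) / 2) = (n : ℝ) ^ (c₃ / 2) := by
    rw [Real.sqrt_eq_rpow, ← Real.rpow_add hn]; congr 1; ring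
  have hκ2 : √(n : ℝ) * ((n : ℝ) ^ ((c₃ - 1) / 2)) ^ 2 = (n : ℝ) ^ (c₃ - 1 / 2) := by
    rw [Real.sqrt_eq_rpow, ← Real.rpow_natCast, ← Real.rpow_mul hn.le, ← Real.rpow_add hn]
    congr 1; push_cast; ring
  refine ⟨hn8, fun p q hp hq => ?_⟩
  have hq' : (q : ℝ) ≤ |M₂| * (n : ℝ) ^ c₂ :=
    hq.trans (mul_le_mul_of_nonneg_right (le_abs_self M₂) (by positivity))
  refine ⟨by positivity, ?_, ?_, ?_, ?_, ?_, ?_⟩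
  · have hlogp : Real.log p ≤ Real.log M + (n : ℝ) ^ c₁ := by
      rcases Nat.eq_zero_or_pos p with rfl | hp0
      · simp only [Nat.cast_zero, Real.log_zero]
        positivity
      · have hp' : (p : ℝ) ≤ M * Real.exp ((n : ℝ) ^ c₁) :=
          hp.trans (mul_le_mul_of_nonneg_right (le_max_left _ _) (Real.exp_pos _).le)
        have hMpos : 0 < M := lt_of_lt_of_le one_pos (le_max_right _ _)
        calc Real.log p ≤ Real.log (M * Real.exp ((n : ℝ) ^ c₁)) :=
              Real.log_le_log (by exact_mod_cast hp0) hp'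
          _ = Real.log M + (n : ℝ) ^ c₁ := by
              rw [Real.log_mul hMpos.ne' (Real.exp_pos _).ne', Real.log_exp]
    have e1 : |M₂| * (n : ℝ) ^ c₂ * Real.log M ≤ ρ ^ 2 / 2 * (n : ℝ) ^ c₃ := by
      have : 2 * |M₂| * Real.log M / ρ ^ 2 ≤ (n : ℝ) ^ (c₃ - c₂) :=
        (le_mul_of_one_le_right (by positivity) hL1).trans h1
      rw [div_le_iff₀ (by positivity), Real.rpow_sub hn, div_mul_eq_mul_div,
        le_div_iff₀ (by positivity)] at this
      linarith
    have e2 : |M₂| * (n : ℝ) ^ c₂ * (n : ℝ) ^ c₁ ≤ ρ ^ 2 / 2 * (n : ℝ) ^ c₃ := by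
      have : 2 * |M₂| / ρ ^ 2 ≤ (n : ℝ) ^ (c₃ - (c₁ + c₂)) :=
        (le_mul_of_one_le_right (by positivity) hL1).trans h2
      rw [div_le_iff₀ (by positivity), Real.rpow_sub hn, div_mul_eq_mul_div,
        le_div_iff₀ (by positivity), Real.rpow_add hn] at this
      linarith
    have e3 : (q : ℝ) * Real.log p ≤ ρ ^ 2 * (n : ℝ) ^ c₃ := by
      calc (q : ℝ) * Real.log p ≤ q * (Real.log M + (n : ℝ) ^ c₁) := by gcongr
        _ ≤ |M₂| * (n : ℝ) ^ c₂ * (Real.log M + (n : ℝ) ^ c₁) := by gcongr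
        _ ≤ ρ ^ 2 * (n : ℝ) ^ c₃ := by linarith
    rw [mul_assoc, hκ1, ← Real.sqrt_mul (Nat.cast_nonneg q)]
    refine Real.sqrt_le_iff.2 ⟨by positivity, e3.trans_eq ?_⟩
    rw [mul_pow, ← Real.rpow_natCast ((n : ℝ) ^ (c₃ / 2)), ← Real.rpow_mul hn.le]
    congr 2; push_cast; ring
  · rw [mul_assoc, hκ2]
    have e1 : |M₂| * (n : ℝ) ^ c₂ * L ≤ ρ * (n : ℝ) ^ (c₃ - 1 / 2) := by
      rw [Real.rpow_sub hn (c₃ - 1 / 2), le_div_iff₀ (by positivity), div_mul_eq_mul_div,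
        div_mul_eq_mul_div, div_le_iff₀ hρ] at h3
      linarith
    calc (q : ℝ) * √L ≤ |M₂| * (n : ℝ) ^ c₂ * L := by gcongr
      _ ≤ _ := e1
  · rw [mul_assoc, hκ1]
    rwa [one_div_mul_eq_div, div_le_iff₀ hρ, mul_comm] at h4
  · rw [mul_assoc, hκ2]
    rw [one_div_mul_eq_div, div_le_iff₀ hρ, mul_comm] at h5
    exact hsqrtL.trans h5
  · rw [one_div_mul_eq_div, div_le_iff₀ hρ] at h6
    have e1 : (n : ℝ) ^ ((1 - c₃) / 2) * (n : ℝ) ^ ((c₃ - 1) / 2) = 1 := by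
      rw [← Real.rpow_add hn, show (1 - c₃) / 2 + (c₃ - 1) / 2 = 0 by ring, Real.rpow_zero]
    calc √L * (n : ℝ) ^ ((c₃ - 1) / 2)
        ≤ ((n : ℝ) ^ ((1 - c₃) / 2) * ρ) * (n : ℝ) ^ ((c₃ - 1) / 2) := by
          gcongr; exact hsqrtL.trans h6
      _ = ρ * ((n : ℝ) ^ ((1 - c₃) / 2) * (n : ℝ) ^ ((c₃ - 1) / 2)) := by ring
      _ = ρ := by rw [e1, mul_one]
  · have : 1 / ρ ≤ √L := Real.le_sqrt_of_sq_le (by rwa [div_pow, one_pow])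
    rw [div_le_iff₀ hρ] at this
    linarith

/-- An event that contains, up to a null set, the preimage of a likely set of noise vectors is
likely. -/
lemma holdsWithProb_of_hasLaw {Ω α : Type*} [MeasurableSpace Ω] [MeasurableSpace α]
    {P : Measure Ω} {μ : Measure α} {Z : Ω → α} (hZ : HasLaw Z μ P) {G : Set α}
    (hG : MeasurableSet G) {a : ℝ} (ha : a ≤ μ.real G) {E : Set Ω}
    (hE : ∀ᵐ ω ∂P, Z ω ∈ G → ω ∈ E) : HoldsWithProb P a E := by
  have hae := hZ.aemeasurable.ae_eq_mk
  obtain ⟨t, ht, mt, htE⟩ := (hae.and hE).exists_measurable_mem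
  refine ⟨t ∩ hZ.aemeasurable.mk Z ⁻¹' G, fun ω hω => ?_,
    mt.inter (hZ.aemeasurable.measurable_mk hG), ha.trans_eq ?_⟩
  · obtain ⟨h1, h2⟩ := htE ω hω.1
    refine h2 ?_
    rw [h1]
    exact hω.2
  · refine (hZ.measureReal_eq hG).symm.trans (measureReal_congr ?_)
    filter_upwards [ht, hae] with ω h1 h2
    refine propext ⟨fun h => ⟨h1, ?_⟩, fun h => ?_⟩
    · change hZ.aemeasurable.mk Z ω ∈ G
      rw [← h2]; exact h
    · change Z ω ∈ G
      rw [h2]; exact h.2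

/-- The conclusion of the theorem for a fixed sample size that is large in the sense of
`Scale`. -/
lemma holdsWithProb_conclusion {n p : ℕ} {X : Matrix (Fin n) (Fin p) ℝ} {β : Fin p → ℝ}
    {lam0 lam σ K K₁ K₂ η ρ κ : ℝ} (hn : 8 ≤ n) (hX : Standardized X) (hσ : 0 < σ) (hK₂ : 0 < K₂)
    (hRE : RestrictedEigenvalue (gram X) (supp β) K₂)
    (hmin : ∀ j ∈ supp β, K₁ * κ < |β j|)
    (hsc : Scale n p (supp β).card ρ κ) (hsm : Smallness σ K K₁ K₂ η ρ)
    (hlam0 : lam0 = 4 * σ * (√(n : ℝ) * √(Real.log p)))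
    (hlam : lam = 4 * σ * (√(n : ℝ) * √(Real.log n)))
    {Ω : Type*} [MeasurableSpace Ω] {P : Measure Ω} {Z : Ω → Fin n → ℝ}
    (hZ : HasLaw Z (gaussianPi n (σ ^ 2).toNNReal) P) {b : ℕ → Ω → Fin p → ℝ}
    (hb : ∀ᵐ ω ∂P, IsMSPPath X (X *ᵥ β + Z ω) lam0 lam fun k => b k ω) :
    HoldsWithProb P (1 - 1 / (n : ℝ)) {ω | ∃ bhat, ConvergesTo (fun k => b k ω) bhat ∧
      l2Norm (bhat - β) ≤ 8 * σ / (K₂ * K) *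
        (√((supp β).card : ℝ) * √(Real.log n) / (√(n : ℝ) * κ)) ∧
      l1Norm (bhat - β) ≤ 4 * (√((supp β).card : ℝ) * (8 * σ / (K₂ * K) *
        (√((supp β).card : ℝ) * √(Real.log n) / (√(n : ℝ) * κ)))) ∧
      ∀ j, SignType.sign (bhat j) = SignType.sign (β j)} := by
  have hn0 : 0 < n := by omega
  have hn' : (0 : ℝ) < n := by positivity
  have hκ := hsc.pos
  have hl1 := hsc.one_le_sqrt_log hsm
  have hκ1 : κ ≤ 1 := by linarith [hsc.κ_le hsm, hsm.ρ_le]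
  have hs : 0 < 1 / (√(n : ℝ) * κ) := by positivity
  set T : Finset (Fin p) := if p ≤ 1 then Finset.univ else supp β with hTdef
  have hT1 : p ≤ 1 → T = Finset.univ := fun h => if_pos h
  have hST : supp β ⊆ T := by
    rw [hTdef]
    split_ifs
    · exact Finset.subset_univ _
    · exact subset_rfl
  have hTcard : T.card ≤ n := by
    rw [hTdef]
    split_ifs with h
    · rw [Finset.card_univ, Fintype.card_fin]; omega
    · have h1 : ((supp β).card : ℝ) ≤ n := by
        have h2 : ((supp β).card : ℝ) ≤ (supp β).card * √(Real.log n) :=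
          le_mul_of_one_le_right (Nat.cast_nonneg _) hl1
        have h3 : ρ * √(n : ℝ) * κ ^ 2 ≤ 1 * √(n : ℝ) * 1 := by
          have : κ ^ 2 ≤ 1 := by nlinarith
          gcongr
          linarith [hsm.ρ_le]
        have h4 : √(n : ℝ) ≤ n := by
          have : (1 : ℝ) ≤ n := by exact_mod_cast hn0
          exact Real.sqrt_le_iff.2 ⟨hn'.le, by nlinarith⟩
        linarith [hsc.sparsity]
      exact_mod_cast h1
  have hsU : 3 * σ ^ 2 * Real.log n ≤ 1 / (√(n : ℝ) * κ) * (√(n : ℝ) / κ)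
      - (1 / (√(n : ℝ) * κ)) ^ 2 * n / 2 := by
    have e1 : 1 / (√(n : ℝ) * κ) * (√(n : ℝ) / κ) - (1 / (√(n : ℝ) * κ)) ^ 2 * n / 2
        = 1 / (2 * κ ^ 2) := by
      rw [div_pow, mul_pow, Real.sq_sqrt hn'.le]
      field_simp
      ring
    rw [e1, le_div_iff₀ (by positivity), ← hsc.sq_sqrt_log]
    have h1 : (√(Real.log n) * κ) ^ 2 ≤ ρ ^ 2 := by
      gcongr
      exact hsc.signal
    have h2 : (3 * (σ * ρ)) ^ 2 ≤ 1 := by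
      have := hsm.ρ_mul_σ
      have := mul_pos hσ hsm.ρ_pos
      nlinarith
    have h3 : σ ^ 2 * (√(Real.log n) * κ) ^ 2 ≤ σ ^ 2 * ρ ^ 2 := by gcongr
    linarith
  have hae : n ^ 4 < p → ∀ τ : ℝ, ∀ᵐ ε ∂gaussianPi n (σ ^ 2).toNNReal,
      ∑ j, (largeEntrySet X β lam0 τ (1 / (√(n : ℝ) * κ)) j).indicator
        (1 : (Fin n → ℝ) → ℝ≥0∞) ε ≤ n := by
    intro hp τ
    have hp1 : 2 ≤ p := by
      have := Nat.one_le_pow 4 n hn0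
      omega
    have hlam0pos : 0 < lam0 := by
      have := four_fifths_le_sqrt_log hp1
      rw [hlam0]; positivity
    have hmeas : Measurable fun ε =>
        ∑ j, (largeEntrySet X β lam0 τ (1 / (√(n : ℝ) * κ)) j).indicator
          (1 : (Fin n → ℝ) → ℝ≥0∞) ε := Finset.measurable_sum _ fun j _ =>
      measurable_one.indicator (isClosed_largeEntrySet X β hlam0pos τ _ j).measurableSet
    rw [← hZ.map_eq, ae_map_iff hZ.aemeasurable (measurableSet_le hmeas measurable_const)]
    filter_upwards [hb] with ω hω
    exact sum_indicator_largeEntrySet_le X hs hω.1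
  obtain ⟨G, mG, hPG, hG⟩ := exists_measurableSet_favourableNoise hX hn β hTcard hσ
    (by rw [hlam0, Real.sqrt_mul hn'.le]) hs hsU hae
  refine holdsWithProb_of_hasLaw hZ mG hPG ?_
  filter_upwards [hb] with ω hω hωG
  exact path_converges_of_favourableNoise hX hn0 hσ hK₂ hRE hmin hsc hsm hlam0 hlam hT1 hST
    (hG _ hωG) hω

lemma HoldsWithProb.mono {Ω : Type*} [MeasurableSpace Ω] {P : Measure Ω} {a : ℝ} {E F : Set Ω}
    (h : HoldsWithProb P a E) (hEF : E ⊆ F) : HoldsWithProb P a F := by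
  obtain ⟨G, hG, mG, ha⟩ := h
  exact ⟨G, hG.trans hEF, mG, ha⟩

end MSP

theorem theorem1 (c₁ c₂ c₃ K₁ K₂ K₃ σ M₁ M₂ : ℝ)
    (hK₁ : 0 < K₁) (hK₂ : 0 < K₂) (hK₃ : 0 < K₃) (hK₃₁ : K₃ < K₁) (hσ : 0 < σ)
    (hc₀ : 0 ≤ c₁ + c₂) (hc₁₂ : c₁ + c₂ < c₃)
    (hc₃_half : 1 / 2 < c₃) (hc₂₃ : (1 + 3 * c₂) / 2 < c₃) (hc₃ : c₃ < 1) :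
    ∃ N : ℕ, ∀ n ≥ N, ∀ (p q : ℕ) (X : Matrix (Fin n) (Fin p) ℝ) (β : Fin p → ℝ)
      (lam0 lam : ℝ),
      (p : ℝ) ≤ M₁ * Real.exp ((n : ℝ) ^ c₁) →
      (q : ℝ) ≤ M₂ * (n : ℝ) ^ c₂ →
      (MSP.supp β).card = q →
      MSP.Standardized X →
      MSP.BetaMin n β c₃ K₁ →
      MSP.RestrictedEigenvalue (MSP.gram X) (MSP.supp β) K₂ →
      lam0 / √(n : ℝ) = 4 * σ * √(Real.log p) →
      lam / √(n : ℝ) = 4 * σ * √(Real.log n) →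
      ∀ (Ω : Type*) [MeasurableSpace Ω] (P : Measure Ω) [IsProbabilityMeasure P]
        (ε : Fin n → Ω → ℝ) (b : ℕ → Ω → Fin p → ℝ),
        MSP.IsGaussianNoise P ε σ →
        (∀ᵐ ω ∂P, MSP.IsMSPPath X (X *ᵥ β + fun i => ε i ω) lam0 lam (fun k => b k ω)) →
        MSP.HoldsWithProb P (1 - 1 / (n : ℝ))
            {ω | ∃ bhat : Fin p → ℝ, MSP.ConvergesTo (fun k => b k ω) bhat ∧
              MSP.l2Norm (bhat - β)
                ≤ 8 * σ / (K₂ * K₃) * √((q : ℝ) * Real.log n / (n : ℝ) ^ c₃) ∧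
              MSP.l1Norm (bhat - β)
                ≤ 32 * σ * (q : ℝ) / (K₂ * K₃) * √(Real.log n / (n : ℝ) ^ c₃)} ∧
          MSP.HoldsWithProb P (1 - 1 / (n : ℝ))
            {ω | ∃ bhat : Fin p → ℝ, MSP.ConvergesTo (fun k => b k ω) bhat ∧
              ∀ j, SignType.sign (bhat j) = SignType.sign (β j)} := by
  obtain ⟨K, η, ρ, hK₃K, hsm⟩ := MSP.exists_smallness hσ hK₂ hK₃ hK₃₁
  obtain ⟨N, hN⟩ := eventually_atTop.1
    (MSP.eventually_scale M₁ M₂ hsm.ρ_pos hc₁₂ hc₃_half hc₂₃ hc₃)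
  refine ⟨N, fun n hnN p q X β lam0 lam hp hq hcard hX hmin hRE hlam0 hlam Ω _ P _ ε b hε hb => ?_⟩
  obtain ⟨hn8, hscale⟩ := hN n hnN
  have hsc := hscale p q hp hq
  subst hcard
  have hn' : (0 : ℝ) < n := by
    have : 0 < n := by omega
    exact_mod_cast this
  have hr : 0 < √(n : ℝ) := Real.sqrt_pos.2 hn'
  rw [div_eq_iff hr.ne'] at hlam0 hlam
  have key := MSP.holdsWithProb_conclusion hn8 hX hσ hK₂ hRE hmin hsc hsm (by rw [hlam0]; ring)
    (by rw [hlam]; ring) (hε.1.hasLaw_pi hε.2) hb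
  set κ := (n : ℝ) ^ ((c₃ - 1) / 2) with hκdef
  have hκ : 0 < κ := hsc.pos
  have hκ2 : (n : ℝ) ^ c₃ = (√(n : ℝ) * κ) ^ 2 := by
    rw [mul_pow, Real.sq_sqrt hn'.le, hκdef, ← Real.rpow_natCast, ← Real.rpow_mul hn'.le]
    nth_rw 2 [← Real.rpow_one (n : ℝ)]
    rw [← Real.rpow_add hn']
    congr 1; push_cast; ring
  have hconst : ∀ c : ℝ, 0 ≤ c → c / (K₂ * K) ≤ c / (K₂ * K₃) := fun c hc => by gcongr
  have hlogn : 0 ≤ Real.log n := Real.log_natCast_nonneg n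
  refine ⟨key.mono ?_, key.mono ?_⟩
  · rintro ω ⟨bhat, hconv, h2, h1, -⟩
    refine ⟨bhat, hconv, h2.trans ?_, h1.trans ?_⟩
    · rw [hκ2, Real.sqrt_div (by positivity), Real.sqrt_sq (by positivity),
        Real.sqrt_mul (Nat.cast_nonneg _)]
      exact mul_le_mul_of_nonneg_right (hconst _ (by positivity)) (by positivity)
    · rw [hκ2, Real.sqrt_div hlogn, Real.sqrt_sq (by positivity)]
      have e : 4 * (√((MSP.supp β).card : ℝ) * (8 * σ / (K₂ * K) *
          (√((MSP.supp β).card : ℝ) * √(Real.log n) / (√(n : ℝ) * κ))))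
          = 32 * σ * (√((MSP.supp β).card : ℝ) * √((MSP.supp β).card : ℝ)) / (K₂ * K) *
            (√(Real.log n) / (√(n : ℝ) * κ)) := by ring
      rw [e, Real.mul_self_sqrt (Nat.cast_nonneg _)]
      exact mul_le_mul_of_nonneg_right (hconst _ (by positivity)) (by positivity)
  · rintro ω ⟨bhat, hconv, -, -, hsign⟩
    exact ⟨bhat, hconv, hsign⟩
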